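/- **Conventions.** Let $K$ be a field. A *transformation-pair* $[\mu,\nu:E\to V]$ over $K$ consists of two $K$-linear maps $\mu,\nu$ between finite-dimensional $K$-vector spaces $E,V$. An isomorphism $[\mu,\nu:E\to V]\to[\mu',\nu':E'\to V']$ is a pair of linear isomorphisms $\alpha:E\to E'$, $\beta:V\to V'$ with $\mu'\alpha=\beta\mu$ and $\nu'\alpha=\beta\nu$; direct sums are formed componentwise. Write $f_1,\dots,f_n$ for the standard basis of $K^n$, $I$ for an identity map, and $\mu_n$ for the nilpotent map $f_1\mapsto f_2\mapsto\cdots\mapsto f_n\mapsto 0$ of $K^n$. *Kronecker's list* consists of - ${}^0T_n=[\mu_n,I:K^n\to K^n]$ and $T_n^0=[I,\mu_n:K^n\to K^n]$ for $n\ge 1$; - $T_n=[\kappa,\lambda:K^n\to K^{n+1}]$ for $n\ge 0$, with $\kappa f_i=f_i$ and $\lambda f_i=f_{i+1}$; - ${}^0T_n^0=[\kappa',\lambda':K^{n+1}\to K^n]$ for $n\ge 0$, with $\kappa' f_i=f_i$ for $i\le n$, $\kappa' f_{n+1}=0$, $\lambda' f_1=0$ and $\lambda' f_{i+1}=f_i$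 for $1\le i\le n$; - $S(p^n)$ for $n\ge 1$ and $p\in K[X]$ monic irreducible, $p\ne X$, where for any monic $F\in K[X]$ we put $S(F)=[X\cdot\,,I:K[X]/(F)\to K[X]/(F)]$. A *Kronecker decomposition* of a transformation-pair is an isomorphism with a finite direct sum of members of this list. Let $\Gamma=(R\subseteq S\times S)$ be a finite binary relation. Its *$K$-linearization* $K(\Gamma)$ is $[\mu,\nu:KR\to KS]$, where $KR$ and $KS$ are the vector spaces with bases $R$ and $S$, and $\mu(s,s')=s$, $\nu(s,s')=s'$. For an equivalence relation $\sim$ on $S$, $\Gamma/{\sim}$ is the relation on $S/{\sim}$ in which $\alpha$ is related to $\beta$ iff $aRb$ for some $a\in\alpha$, $b\in\beta$. The *left contraction* $C_l\Gamma$ (resp. *right contraction* $C_r\Gamma$) is $\Gamma/{\sim}$ for the smallest equivalence relation such that $xRy$ and $xRy'$ imply $y\sim y'$ (resp. $xRy$ and $x'Ry$ imply $x\sim x'$). The *$C$-stabilization* $C^{\infty,\infty}\Gamma$ is the common value, up to isomorphism, of $C_l^mC_r^n\Gamma$ for all sufficiently large $m,n$. For $N\ge1$, the path $L(N)$ has vertices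 $v_1,\dots,v_N$ and edges $(v_i,v_{i+1})$ for $1\le i<N$; the cycle $C(N)$ has in addition the edge $(v_N,v_1)$. **Theorem 5.4 (Main Theorem, Part Two).** Let $K$ be a field and $\Gamma=(R\subseteq S\times S)$ a finite binary relation with $K$-linearization $K(\Gamma)$. Let $C^{\infty,\infty}\Gamma$ be isomorphic to the disjoint union of $p\ge 0$ paths $L(m_1),\dots,L(m_p)$ and $q\ge 0$ cycles $C(n_1),\dots,C(n_q)$, with all $m_i,n_j\ge1$. Then $K(\Gamma)$ has a Kronecker decomposition, and for every Kronecker decomposition of $K(\Gamma)$: a) the summands of type $T_n$ are, multiplicity included, $T_{m_1-1},T_{m_2-1},\dots,T_{m_p-1}$; in other words, for every integer $n\ge0$ the number of summands equal to $T_n$ is the number of indices $i$ with $m_i=n+1$; b) the direct sum of the summands of type $S(p(X)^n)$ is isomorphic to $$\bigoplus_{i=1}^q S(X^{n_i}-1).$$ -/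

import Mathlib

open Polynomial

universe u v w

/-! ### Binary relations and their contractions -/

/-- A binary relation `Γ = (R, S)` on a set `S`, i.e. a directed graph without parallel edges
(loops are allowed); the set `S` is part of the data. -/
structure BinRel : Type (v + 1) where
  /-- the vertex set `S` -/
  carrier : Type v
  /-- the edge relation `R ⊆ S × S` -/
  rel : carrier → carrier → Prop

namespace BinRel

/-- The quotient `Γ/∼` on `S/∼`: `α (R/∼) β` iff `a R b` for some `a ∈ α`, `b ∈ β`. -/
def quotient (Γ : BinRel.{v}) (s : Setoid Γ.carrier) : BinRel.{v} where
  carrier := Quotient s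
  rel α β := ∃ a b, Quotient.mk s a = α ∧ Quotient.mk s b = β ∧ Γ.rel a b

/-- The smallest equivalence relation with `y ∼ y'` whenever `x R y` and `x R y'`. -/
def leftSetoid (Γ : BinRel.{v}) : Setoid Γ.carrier :=
  Relation.EqvGen.setoid fun y y' => ∃ x, Γ.rel x y ∧ Γ.rel x y'

/-- The smallest equivalence relation with `x ∼ x'` whenever `x R y` and `x' R y`. -/
def rightSetoid (Γ : BinRel.{v}) : Setoid Γ.carrier :=
  Relation.EqvGen.setoid fun x x' => ∃ y, Γ.rel x y ∧ Γ.rel x' y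

/-- The left contraction `C_l Γ`. -/
def leftContraction (Γ : BinRel.{v}) : BinRel.{v} := Γ.quotient Γ.leftSetoid

/-- The right contraction `C_r Γ`. -/
def rightContraction (Γ : BinRel.{v}) : BinRel.{v} := Γ.quotient Γ.rightSetoid

/-- Graph isomorphisms. -/
abbrev Iso (Γ : BinRel.{v}) (Δ : BinRel.{w}) := Γ.rel ≃r Δ.rel

/-- The `C`-stabilization `C^{∞,∞} Γ` of a finite binary relation `Γ`: the common value, up to
isomorphism, of `C_l^m C_r^n Γ` for all sufficiently large `m` and `n`.  Exponents equal to the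
number of vertices are large enough: see `nonempty_iso_cStabilization`. -/
noncomputable def cStabilization (Γ : BinRel.{v}) : BinRel.{v} :=
  leftContraction^[Nat.card Γ.carrier] (rightContraction^[Nat.card Γ.carrier] Γ)

theorem quotient_congr {Γ Δ : BinRel.{v}} (e : Iso Γ Δ)
    {g : Γ.carrier → Γ.carrier → Prop} {h : Δ.carrier → Δ.carrier → Prop}
    (H : ∀ a b, g a b ↔ h (e a) (e b)) :
    Nonempty (Iso (Γ.quotient (Relation.EqvGen.setoid g))
      (Δ.quotient (Relation.EqvGen.setoid h))) := by
  have fwd : ∀ a b, Relation.EqvGen g a b → Relation.EqvGen h (e a) (e b) := by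
    intro a b hab
    induction hab with
    | rel a b hab => exact .rel _ _ ((H a b).1 hab)
    | refl a => exact .refl _
    | symm a b _ ih => exact .symm _ _ ih
    | trans a b c _ _ ih1 ih2 => exact .trans _ _ _ ih1 ih2
  have bwd : ∀ a b, Relation.EqvGen h a b → Relation.EqvGen g (e.symm a) (e.symm b) := by
    intro a b hab
    induction hab with
    | rel a b hab =>
      refine .rel _ _ ((H _ _).2 ?_)
      simpa using hab
    | refl a => exact .refl _
    | symm a b _ ih => exact .symm _ _ ih
    | trans a b c _ _ ih1 ih2 => exact .trans _ _ _ ih1 ih2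
  let q : Quotient (Relation.EqvGen.setoid g) ≃ Quotient (Relation.EqvGen.setoid h) :=
    Quotient.congr e.toEquiv (fun a b => ⟨fun hab => fwd a b hab, fun hab => by
      have h1 := bwd _ _ hab
      have h2 : Relation.EqvGen g a b := by simpa using h1
      exact h2⟩)
  refine ⟨⟨q, ?_⟩⟩
  intro α β
  constructor
  · rintro ⟨a, b, ha, hb, hab⟩
    refine ⟨e.symm a, e.symm b, ?_, ?_, ?_⟩
    · apply q.injective
      refine Eq.trans ?_ ha
      change Quotient.mk _ (e (e.symm a)) = _
      simp
    · apply q.injective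
      refine Eq.trans ?_ hb
      change Quotient.mk _ (e (e.symm b)) = _
      simp
    · exact e.symm.map_rel_iff.2 hab
  · rintro ⟨a, b, rfl, rfl, hab⟩
    exact ⟨e a, e b, rfl, rfl, e.map_rel_iff.2 hab⟩

theorem leftContraction_congr {Γ Δ : BinRel.{v}} (e : Iso Γ Δ) :
    Nonempty (Iso Γ.leftContraction Δ.leftContraction) := by
  refine quotient_congr e fun a b => ⟨?_, ?_⟩
  · rintro ⟨x, h1, h2⟩
    exact ⟨e x, e.map_rel_iff.2 h1, e.map_rel_iff.2 h2⟩
  · rintro ⟨x, h1, h2⟩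
    refine ⟨e.symm x, ?_, ?_⟩
    · rw [← e.map_rel_iff]; simpa using h1
    · rw [← e.map_rel_iff]; simpa using h2

theorem rightContraction_congr {Γ Δ : BinRel.{v}} (e : Iso Γ Δ) :
    Nonempty (Iso Γ.rightContraction Δ.rightContraction) := by
  refine quotient_congr e fun a b => ⟨?_, ?_⟩
  · rintro ⟨x, h1, h2⟩
    exact ⟨e x, e.map_rel_iff.2 h1, e.map_rel_iff.2 h2⟩
  · rintro ⟨x, h1, h2⟩
    refine ⟨e.symm x, ?_, ?_⟩
    · rw [← e.map_rel_iff]; simpa using h1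
    · rw [← e.map_rel_iff]; simpa using h2

theorem quotient_iso_or_card_lt (Γ : BinRel.{v}) [Finite Γ.carrier] (s : Setoid Γ.carrier) :
    Nonempty (Iso (Γ.quotient s) Γ) ∨
      (Finite (Γ.quotient s).carrier ∧ Nat.card (Γ.quotient s).carrier < Nat.card Γ.carrier) := by
  by_cases hinj : Function.Injective (Quotient.mk s)
  · left
    let q : Γ.carrier ≃ Quotient s := Equiv.ofBijective _ ⟨hinj, Quotient.mk_surjective⟩
    refine ⟨RelIso.symm ⟨q, ?_⟩⟩
    intro a b
    constructor
    · rintro ⟨x, y, hx, hy, hxy⟩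
      rw [hinj hx, hinj hy] at hxy
      exact hxy
    · intro hab
      exact ⟨a, b, rfl, rfl, hab⟩
  · right
    have hf : Finite (Quotient s) := inferInstance
    refine ⟨hf, ?_⟩
    have hle : Nat.card (Quotient s) ≤ Nat.card Γ.carrier :=
      Nat.card_le_card_of_surjective _ (Quotient.mk_surjective (s := s))
    refine lt_of_le_of_ne hle fun heq => hinj ?_
    exact ((Nat.bijective_iff_surjective_and_card _).2
      ⟨Quotient.mk_surjective (s := s), heq.symm⟩).injective

theorem iterate_congr {f : BinRel.{v} → BinRel.{v}}
    (hf : ∀ {Γ Δ : BinRel.{v}}, Iso Γ Δ → Nonempty (Iso (f Γ) (f Δ))) (n : ℕ) :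
    ∀ {Γ Δ : BinRel.{v}}, Iso Γ Δ → Nonempty (Iso (f^[n] Γ) (f^[n] Δ)) := by
  induction n with
  | zero => exact fun e => ⟨e⟩
  | succ n ih => exact fun e => (hf e).elim fun e' => ih e'

theorem iterate_stable {f : BinRel.{v} → BinRel.{v}}
    (hf : ∀ {Γ Δ : BinRel.{v}}, Iso Γ Δ → Nonempty (Iso (f Γ) (f Δ)))
    (hq : ∀ (Γ : BinRel.{v}) [Finite Γ.carrier], Nonempty (Iso (f Γ) Γ) ∨
      (Finite (f Γ).carrier ∧ Nat.card (f Γ).carrier < Nat.card Γ.carrier)) (k : ℕ) :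
    ∀ (Γ : BinRel.{v}) [Finite Γ.carrier], Nat.card Γ.carrier ≤ k →
      ∀ n, k ≤ n → Nonempty (Iso (f^[n] Γ) (f^[k] Γ)) := by
  have fixed : ∀ Γ : BinRel.{v}, Nonempty (Iso (f Γ) Γ) → ∀ n, Nonempty (Iso (f^[n] Γ) Γ) := by
    rintro Γ ⟨e⟩ n
    induction n with
    | zero => exact ⟨RelIso.refl _⟩
    | succ n ih =>
      obtain ⟨e1⟩ := ih
      obtain ⟨e2⟩ := iterate_congr hf n e
      exact ⟨RelIso.trans e2 e1⟩
  induction k with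
  | zero =>
    intro Γ _ hc n _
    rcases hq Γ with h | h
    · exact fixed Γ h n
    · omega
  | succ k ih =>
    intro Γ _ hc n hn
    rcases hq Γ with h | ⟨hfin, h⟩
    · obtain ⟨e1⟩ := fixed Γ h n
      obtain ⟨e2⟩ := fixed Γ h (k + 1)
      exact ⟨RelIso.trans e1 (RelIso.symm e2)⟩
    · obtain ⟨n, rfl⟩ : ∃ n', n = n' + 1 := ⟨n - 1, by omega⟩
      exact ih (f Γ) (by omega) n (by omega)

theorem iterate_right_finite (Γ : BinRel.{v}) [Finite Γ.carrier] (n : ℕ) :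
    Finite (rightContraction^[n] Γ).carrier ∧
      Nat.card (rightContraction^[n] Γ).carrier ≤ Nat.card Γ.carrier := by
  induction n with
  | zero => exact ⟨‹Finite Γ.carrier›, le_rfl⟩
  | succ n ih =>
    rw [Function.iterate_succ_apply']
    obtain ⟨h1, h2⟩ := ih
    refine ⟨inferInstanceAs (Finite (Quotient _)), le_trans ?_ h2⟩
    exact Nat.card_le_card_of_surjective _
      (Quotient.mk_surjective (s := (rightContraction^[n] Γ).rightSetoid))

/-- `C_l^m C_r^n Γ` does not depend, up to isomorphism, on `m` and `n` as soon as both are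
sufficiently large; its common value is `C^{∞,∞} Γ`. -/
theorem nonempty_iso_cStabilization (Γ : BinRel.{v}) [Finite Γ.carrier] (m n : ℕ)
    (hm : Nat.card Γ.carrier ≤ m) (hn : Nat.card Γ.carrier ≤ n) :
    Nonempty (Iso (leftContraction^[m] (rightContraction^[n] Γ)) Γ.cStabilization) := by
  obtain ⟨e1⟩ := iterate_stable rightContraction_congr
    (fun Γ _ => quotient_iso_or_card_lt Γ Γ.rightSetoid) _ Γ le_rfl n hn
  obtain ⟨e2⟩ := iterate_congr leftContraction_congr m e1
  obtain ⟨h1, h2⟩ := iterate_right_finite Γ (Nat.card Γ.carrier)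
  obtain ⟨e3⟩ := iterate_stable leftContraction_congr
    (fun Γ _ => quotient_iso_or_card_lt Γ Γ.leftSetoid) _ _ h2 m hm
  exact ⟨RelIso.trans e2 e3⟩

/-- The path `L(N)`: vertices `v_1, …, v_N` and the `N - 1` edges `(v_i, v_{i+1})`. -/
def path (N : ℕ) : BinRel.{0} where
  carrier := Fin N
  rel i j := (i : ℕ) + 1 = j

/-- The cycle `C(N)`: vertices `v_1, …, v_N` and the `N` edges `(v_i, v_{i+1})`, indices
modulo `N` (for `N = 1`, one vertex with a loop). -/
def cycle (N : ℕ) : BinRel.{0} where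
  carrier := Fin N
  rel i j := ((i : ℕ) + 1) % N = j

/-- Two vertices of a disjoint union are related iff they lie in the same part and are
related there. -/
inductive DisjointUnionRel {ι : Type w} (G : ι → BinRel.{v}) :
    (Σ i, (G i).carrier) → (Σ i, (G i).carrier) → Prop
  | mk (i : ι) (a b : (G i).carrier) (h : (G i).rel a b) : DisjointUnionRel G ⟨i, a⟩ ⟨i, b⟩

/-- The disjoint union of a family of binary relations. -/
def disjointUnion {ι : Type w} (G : ι → BinRel.{v}) : BinRel.{max w v} where
  carrier := Σ i, (G i).carrier
  rel := DisjointUnionRel G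

end BinRel

/-! ### Transformation-pairs -/

/-- A transformation-pair `[μ, ν : E → V]` over `K`: two linear maps between the same two
finite-dimensional vector spaces. -/
structure TsfPair (K : Type u) [Field K] : Type (max u (v + 1)) where
  E : Type v
  V : Type v
  [addCommGroupE : AddCommGroup E]
  [addCommGroupV : AddCommGroup V]
  [moduleE : Module K E]
  [moduleV : Module K V]
  [finiteE : Module.Finite K E]
  [finiteV : Module.Finite K V]
  μ : E →ₗ[K] V
  ν : E →ₗ[K] V

attribute [instance] TsfPair.addCommGroupE TsfPair.addCommGroupV TsfPair.moduleE
  TsfPair.moduleV TsfPair.finiteE TsfPair.finiteV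

namespace TsfPair

variable {K : Type u} [Field K]

/-- A `K`-isomorphism `(α, β)` of transformation-pairs. -/
structure Iso (π : TsfPair.{u, v} K) (π' : TsfPair.{u, w} K) where
  α : π.E ≃ₗ[K] π'.E
  β : π.V ≃ₗ[K] π'.V
  comm_μ : ∀ x, π'.μ (α x) = β (π.μ x)
  comm_ν : ∀ x, π'.ν (α x) = β (π.ν x)

/-- The direct sum of a finite family of transformation-pairs (for a finite index set the direct
sum of vector spaces is the product). -/
def directSum {ι : Type w} [Finite ι] (π : ι → TsfPair.{u, v} K) : TsfPair.{u, max w v} K where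
  E := ∀ i, (π i).E
  V := ∀ i, (π i).V
  μ := LinearMap.pi fun i => (π i).μ ∘ₗ LinearMap.proj i
  ν := LinearMap.pi fun i => (π i).ν ∘ₗ LinearMap.proj i

/-- The linear map out of `K^n` with prescribed values on the standard basis. -/
noncomputable def ofBasis (K : Type u) [Field K] {n m : ℕ} (f : Fin n → Fin m → K) :
    (Fin n → K) →ₗ[K] (Fin m → K) :=
  (Pi.basisFun K (Fin n)).constr K f

/-- The nilpotent map `f_1 ↦ f_2 ↦ ⋯ ↦ f_n ↦ 0` of `K^n`. -/
noncomputable def nilp (K : Type u) [Field K] (n : ℕ) : (Fin n → K) →ₗ[K] (Fin n → K) :=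
  ofBasis K fun i => if h : (i : ℕ) + 1 < n then Pi.single ⟨i + 1, h⟩ 1 else 0

/-- Type `⁰T_n` (for `n ≥ 1`): `[μ_n, I : K^n → K^n]`. -/
noncomputable def zeroT (K : Type u) [Field K] (n : ℕ) : TsfPair.{u, u} K where
  E := Fin n → K
  V := Fin n → K
  μ := nilp K n
  ν := LinearMap.id

/-- Type `T_n⁰` (for `n ≥ 1`): `[I, μ_n : K^n → K^n]`. -/
noncomputable def tZero (K : Type u) [Field K] (n : ℕ) : TsfPair.{u, u} K where
  E := Fin n → K
  V := Fin n → K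
  μ := LinearMap.id
  ν := nilp K n

/-- Type `T_n` (for `n ≥ 0`): `[κ, λ : K^n → K^{n+1}]` with `κ f_i = f_i` and
`λ f_i = f_{i+1}`. -/
noncomputable def tType (K : Type u) [Field K] (n : ℕ) : TsfPair.{u, u} K where
  E := Fin n → K
  V := Fin (n + 1) → K
  μ := ofBasis K fun i => Pi.single i.castSucc 1
  ν := ofBasis K fun i => Pi.single i.succ 1

/-- Type `⁰T_n⁰` (for `n ≥ 0`): `[κ', λ' : K^{n+1} → K^n]` with `κ' f_i = f_i` for `i ≤ n`,
`κ' f_{n+1} = 0`, and `λ' f_1 = 0`, `λ' f_{i+1} = f_i`. -/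
noncomputable def zeroTZero (K : Type u) [Field K] (n : ℕ) : TsfPair.{u, u} K where
  E := Fin (n + 1) → K
  V := Fin n → K
  μ := ofBasis K fun i => Fin.lastCases (motive := fun _ => Fin n → K) 0
    (fun j => Pi.single j 1) i
  ν := ofBasis K fun i => Fin.cases (motive := fun _ => Fin n → K) 0
    (fun j => Pi.single j 1) i

/-- `S(F)` for a monic polynomial `F`: `[X·, I : K[X]/(F) → K[X]/(F)]`. -/
noncomputable def sType (F : K[X]) (hF : F.Monic) : TsfPair.{u, u} K :=
  haveI : Module.Finite K (AdjoinRoot F) := hF.finite_adjoinRoot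
  { E := AdjoinRoot F
    V := AdjoinRoot F
    μ := LinearMap.mulLeft K (AdjoinRoot.root F)
    ν := LinearMap.id }

end TsfPair

/-- Kronecker's list of indecomposable types over `K`. -/
inductive KroneckerType (K : Type u) [Field K] : Type u
  | zeroT (n : ℕ) (hn : 1 ≤ n)
  | tZero (n : ℕ) (hn : 1 ≤ n)
  | tType (n : ℕ)
  | zeroTZero (n : ℕ)
  | sType (p : K[X]) (n : ℕ) (hp : p.Monic) (hirr : Irreducible p) (hX : p ≠ X) (hn : 1 ≤ n)

namespace KroneckerType

variable {K : Type u} [Field K]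

/-- The transformation-pair of a type in Kronecker's list. -/
noncomputable def toPair : KroneckerType K → TsfPair.{u, u} K
  | zeroT n _ => TsfPair.zeroT K n
  | tZero n _ => TsfPair.tZero K n
  | tType n => TsfPair.tType K n
  | zeroTZero n => TsfPair.zeroTZero K n
  | sType p n hp _ _ _ => TsfPair.sType (p ^ n) (hp.pow n)

/-- The types `S(p^n)`. -/
def IsSType : KroneckerType K → Prop
  | sType _ _ _ _ _ _ => True
  | _ => False

end KroneckerType

/-- The family `κ` is a Kronecker decomposition of `π`: `π` is isomorphic to the direct sum of the
indecomposable objects `κ 0, …, κ (r - 1)` of Kronecker's list. -/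
def TsfPair.IsKroneckerDecomposition {K : Type u} [Field K] (π : TsfPair.{u, v} K) {r : ℕ}
    (κ : Fin r → KroneckerType K) : Prop :=
  Nonempty (TsfPair.Iso π (TsfPair.directSum fun i => (κ i).toPair))

/-- The `K`-linearization `K(Γ) = [μ, ν : KR → KS]` of a finite binary relation `Γ = (R, S)`:
an edge `(s, s')` is sent by `μ` to `s` and by `ν` to `s'`. -/
noncomputable def BinRel.linearization (K : Type u) [Field K] (Γ : BinRel.{v})
    [Finite Γ.carrier] : TsfPair.{u, max v u} K where
  E := {e : Γ.carrier × Γ.carrier // Γ.rel e.1 e.2} →₀ K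
  V := Γ.carrier →₀ K
  μ := Finsupp.lmapDomain K K fun e => e.1.1
  ν := Finsupp.lmapDomain K K fun e => e.1.2

-- Existence rests on how little a contraction forgets. On the linear side the left contraction of
-- `[μ, ν : E → V]` is `[E/ker μ → V/ν(ker μ)]`, and a pair is determined up to isomorphism by its
-- left contraction and the dimensions of `E` and `V` (`LeftContraction.nonempty_iso`). So a
-- decomposition of the contraction lifts: each summand is replaced by one contracting onto it as
-- economically as possible (`Tight`), and the missing dimensions are filled with copies of `⁰T_1`
-- and `⁰T_0⁰` (`LeftContraction.exists_lift`). Summands with `μ` injective are their own lifts, and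
-- null types lift to null types.
--
-- On the combinatorial side, the linearization of `C_l Γ` is the left contraction of `K(Γ)`, except
-- that edges which become parallel are merged; this only discards summands `⁰T_0⁰`
-- (`NullExtension`). Right contractions follow by exchanging `μ` and `ν`. Going back from `C^{∞,∞}
-- Γ`, where paths give `T_{m-1}` and cycles give `S(X^n - 1)`, one finds that `K(Γ)` is the sum of
-- these pairs and of null types (`BinRel.isSumWithNull_linearization`). The Chinese remainder
-- theorem splits `S(X^n - 1)` into members of the list.
--
-- For uniqueness, a pair is viewed as the linear relation `μ e ↦ ν e` on `V`. The subspaces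
-- `nullSpace` and `iterDomain` are preserved by homomorphisms, hence split along direct sums. For
-- large `k`, the second difference in `t` of `dim (iterDomain t + nullSpace k)` counts the summands
-- `T_t` (`card_path`), and the image of `iterDomain k` modulo `nullSpace k` recovers the sum of the
-- summands `S(p^n)` (`RegularPart.nonempty_iso`). Comparing an arbitrary Kronecker decomposition
-- with the sum found above gives both claims.

universe v₁ v₂ v₃ w₁ w₂

/-! ### Extending and lifting isomorphisms of vector spaces -/

section LinearAlgebra

variable {K : Type*} [Field K] {A M N M' N' : Type*}
  [AddCommGroup A] [Module K A]
  [AddCommGroup M] [Module K M] [AddCommGroup N] [Module K N]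
  [AddCommGroup M'] [Module K M'] [AddCommGroup N'] [Module K N']

/-- Two linear maps out of the same space with equal kernels differ by an isomorphism of their
codomains, if these have the same dimension. -/
theorem LinearMap.exists_equiv_comp_eq_of_ker_eq [Module.Finite K M] [Module.Finite K M']
    (φ : A →ₗ[K] M) (φ' : A →ₗ[K] M') (hker : LinearMap.ker φ = LinearMap.ker φ')
    (hdim : Module.finrank K M = Module.finrank K M') :
    ∃ β : M ≃ₗ[K] M', ∀ a, β (φ a) = φ' a := by
  obtain ⟨C, hC⟩ := Submodule.exists_isCompl (LinearMap.range φ)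
  obtain ⟨C', hC'⟩ := Submodule.exists_isCompl (LinearMap.range φ')
  let e : LinearMap.range φ ≃ₗ[K] LinearMap.range φ' :=
    φ.quotKerEquivRange.symm ≪≫ₗ Submodule.quotEquivOfEq _ _ hker ≪≫ₗ φ'.quotKerEquivRange
  have he : ∀ a, e ⟨φ a, LinearMap.mem_range_self φ a⟩ = ⟨φ' a, LinearMap.mem_range_self φ' a⟩ := by
    intro a
    have h : φ.quotKerEquivRange.symm ⟨φ a, LinearMap.mem_range_self φ a⟩ =
        Submodule.Quotient.mk a := by
      rw [LinearEquiv.symm_apply_eq]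
      rfl
    simp only [e, LinearEquiv.trans_apply, h]
    rfl
  have h1 := Submodule.finrank_add_eq_of_isCompl hC
  have h2 := Submodule.finrank_add_eq_of_isCompl hC'
  have h3 := e.finrank_eq
  -- Both ranges are `A` modulo the common kernel, so their complements have equal dimension, and
  -- any isomorphism between the complements will do.
  let c : C ≃ₗ[K] C' := LinearEquiv.ofFinrankEq _ _ (by omega)
  refine ⟨(Submodule.prodEquivOfIsCompl _ _ hC).symm ≪≫ₗ (e.prodCongr c) ≪≫ₗ
    Submodule.prodEquivOfIsCompl _ _ hC', fun a => ?_⟩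
  have h : (Submodule.prodEquivOfIsCompl _ _ hC).symm (φ a) =
      (⟨φ a, LinearMap.mem_range_self φ a⟩, 0) := by
    rw [LinearEquiv.symm_apply_eq]
    simp
  simp only [LinearEquiv.trans_apply, h, LinearEquiv.prodCongr_apply, he, map_zero]
  simp

/-- An isomorphism between the codomains of two surjections lifts to their domains, if these have
the same dimension. -/
theorem LinearMap.exists_equiv_lift_of_surjective [Module.Finite K N] [Module.Finite K N']
    (ν : N →ₗ[K] M) (ν' : N' →ₗ[K] M') (hν : Function.Surjective ν)
    (hν' : Function.Surjective ν') (β : M ≃ₗ[K] M')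
    (hdim : Module.finrank K N = Module.finrank K N') :
    ∃ α : N ≃ₗ[K] N', ∀ x, ν' (α x) = β (ν x) := by
  obtain ⟨r, hr⟩ := ν.exists_rightInverse_of_surjective (LinearMap.range_eq_top.2 hν)
  obtain ⟨r', hr'⟩ := ν'.exists_rightInverse_of_surjective (LinearMap.range_eq_top.2 hν')
  have hr0 : ∀ x, ν (r x) = x := fun x => LinearMap.congr_fun hr x
  have hr0' : ∀ x, ν' (r' x) = x := fun x => LinearMap.congr_fun hr' x
  have h1 := ν.finrank_range_add_finrank_ker
  have h2 := ν'.finrank_range_add_finrank_ker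
  rw [LinearMap.range_eq_top.2 hν, finrank_top] at h1
  rw [LinearMap.range_eq_top.2 hν', finrank_top] at h2
  have h3 := β.finrank_eq
  let c : LinearMap.ker ν ≃ₗ[K] LinearMap.ker ν' := LinearEquiv.ofFinrankEq _ _ (by omega)
  let k : N →ₗ[K] LinearMap.ker ν := (LinearMap.id - r ∘ₗ ν).codRestrict _ fun x => by
    simp [hr0]
  -- The section `r` splits `N` as `r(M) ⊕ ker ν`; `α` is `β` on the first summand and the arbitrary
  -- isomorphism `c` on the kernel.
  let α : N →ₗ[K] N' := r' ∘ₗ β.toLinearMap ∘ₗ ν + (LinearMap.ker ν').subtype ∘ₗ c.toLinearMap ∘ₗ k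
  have hα : ∀ x, ν' (α x) = β (ν x) := by
    intro x
    have h : ν' (c (k x) : N') = 0 := (c (k x)).2
    simp [α, hr0', h]
  have hinj : Function.Injective α := by
    rw [← LinearMap.ker_eq_bot, LinearMap.ker_eq_bot']
    intro x hx
    have hνx : ν x = 0 := by
      have := hα x
      rw [hx, map_zero] at this
      exact (LinearEquiv.map_eq_zero_iff β).1 this.symm
    have h4 : (c (k x) : N') = 0 := by
      simpa [α, hνx] using hx
    have h5 : k x = 0 := by
      rw [← LinearEquiv.map_eq_zero_iff c]
      exact Subtype.ext h4
    have h6 : x - r (ν x) = 0 := congrArg Subtype.val h5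
    simpa [hνx] using h6
  exact ⟨LinearEquiv.ofInjectiveOfFinrankEq α hinj hdim, fun x => hα x⟩

end LinearAlgebra

/-! ### Isomorphisms and direct sums of transformation-pairs -/

namespace TsfPair

variable {K : Type u} [Field K]

/-- The identity isomorphism. -/
def Iso.refl (π : TsfPair.{u, v} K) : Iso π π where
  α := LinearEquiv.refl K _
  β := LinearEquiv.refl K _
  comm_μ _ := rfl
  comm_ν _ := rfl

/-- The inverse isomorphism. -/
def Iso.symm {π : TsfPair.{u, v} K} {π' : TsfPair.{u, w} K} (e : Iso π π') : Iso π' π where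
  α := e.α.symm
  β := e.β.symm
  comm_μ x := by
    rw [LinearEquiv.eq_symm_apply, ← e.comm_μ, LinearEquiv.apply_symm_apply]
  comm_ν x := by
    rw [LinearEquiv.eq_symm_apply, ← e.comm_ν, LinearEquiv.apply_symm_apply]

/-- Composition of isomorphisms. -/
def Iso.trans {π : TsfPair.{u, v₁} K} {π' : TsfPair.{u, v₂} K} {π'' : TsfPair.{u, v₃} K}
    (e : Iso π π') (e' : Iso π' π'') : Iso π π'' where
  α := e.α ≪≫ₗ e'.α
  β := e.β ≪≫ₗ e'.β
  comm_μ x := by simp [e.comm_μ, e'.comm_μ]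
  comm_ν x := by simp [e.comm_ν, e'.comm_ν]

/-- Exchanging the two maps of a transformation-pair. -/
def swap (π : TsfPair.{u, v} K) : TsfPair.{u, v} K where
  E := π.E
  V := π.V
  μ := π.ν
  ν := π.μ

/-- An isomorphism stays one when the two maps are exchanged. -/
def Iso.swap {π : TsfPair.{u, v} K} {π' : TsfPair.{u, w} K} (e : Iso π π') :
    Iso π.swap π'.swap where
  α := e.α
  β := e.β
  comm_μ := e.comm_ν
  comm_ν := e.comm_μ

/-- Componentwise isomorphisms of direct sums. -/
def Iso.directSum {ι : Type w} [Finite ι] {P : ι → TsfPair.{u, v₁} K} {Q : ι → TsfPair.{u, v₂} K}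
    (e : ∀ i, Iso (P i) (Q i)) : Iso (directSum P) (directSum Q) where
  α := LinearEquiv.piCongrRight fun i => (e i).α
  β := LinearEquiv.piCongrRight fun i => (e i).β
  comm_μ x := funext fun i => (e i).comm_μ (x i)
  comm_ν x := funext fun i => (e i).comm_ν (x i)

/-- A direct sum of direct sums is a direct sum over a sigma type. -/
def Iso.sigma {ι : Type w₁} [Finite ι] {κ : ι → Type w₂} [∀ i, Finite (κ i)]
    (P : ∀ i, κ i → TsfPair.{u, v} K) :
    Iso (TsfPair.directSum fun x : Σ i, κ i => P x.1 x.2)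
      (TsfPair.directSum fun i => TsfPair.directSum (P i)) where
  α := LinearEquiv.piCurry K fun i j => (P i j).E
  β := LinearEquiv.piCurry K fun i j => (P i j).V
  comm_μ _ := rfl
  comm_ν _ := rfl

/-- The coordinates outside the range of `e` carry no information. The family is dependent, so a
preimage has to be transported along `e (chosen index) = k`. -/
theorem bijective_restrict {ι : Type w₁} {κ : Type w₂} (e : ι → κ) (he : Function.Injective e)
    (X : κ → Type v) (hX : ∀ k, k ∉ Set.range e → Nonempty (Unique (X k))) :
    Function.Bijective fun (x : ∀ k, X k) (i : ι) => x (e i) := by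
  constructor
  · intro x y hxy
    funext k
    by_cases hk : k ∈ Set.range e
    · obtain ⟨i, rfl⟩ := hk
      exact congrFun hxy i
    · obtain ⟨h⟩ := hX k hk
      exact Subsingleton.elim _ _
  · intro y
    classical
    refine ⟨fun k => if hk : k ∈ Set.range e then
      (congrArg X hk.choose_spec).mp (y hk.choose) else (hX k hk).some.default, ?_⟩
    funext i
    have hi : e i ∈ Set.range e := ⟨i, rfl⟩
    simp only [hi, dif_pos]
    have hc : hi.choose = i := he hi.choose_spec
    -- The cast depends on the chosen index; quantifying over its proof allows that index to be
    -- rewritten to `i`.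
    generalize_proofs h1 h2
    revert h2
    change ∀ h2 : X (e h1.choose) = X (e i), h2.mp (y h1.choose) = y i
    rw [hc]
    intro _
    rfl

/-- Restriction of a direct sum to an index set outside of which all summands vanish. -/
theorem nonempty_iso_directSum_restrict {ι : Type w₁} {κ : Type w₂} [Finite ι] [Finite κ]
    (e : ι → κ) (he : Function.Injective e) (P : κ → TsfPair.{u, v} K)
    (hE : ∀ k, k ∉ Set.range e → Subsingleton (P k).E)
    (hV : ∀ k, k ∉ Set.range e → Subsingleton (P k).V) :
    Nonempty (Iso (directSum P) (directSum fun i => P (e i))) := by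
  refine ⟨⟨LinearEquiv.ofBijective (LinearMap.pi fun i => LinearMap.proj (e i)) ?_,
    LinearEquiv.ofBijective (LinearMap.pi fun i => LinearMap.proj (e i)) ?_, ?_, ?_⟩⟩
  · exact bijective_restrict e he _ fun k hk =>
      ⟨⟨⟨0⟩, fun a => (hE k hk).elim _ _⟩⟩
  · exact bijective_restrict e he _ fun k hk =>
      ⟨⟨⟨0⟩, fun a => (hV k hk).elim _ _⟩⟩
  · exact fun _ => rfl
  · exact fun _ => rfl

theorem nonempty_iso_directSum_reindex {ι : Type w₁} {κ : Type w₂} [Finite ι] [Finite κ]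
    (e : ι ≃ κ) {P : ι → TsfPair.{u, v₁} K} {Q : κ → TsfPair.{u, v₂} K}
    (h : ∀ i, Nonempty (Iso (P i) (Q (e i)))) :
    Nonempty (Iso (directSum P) (directSum Q)) := by
  obtain ⟨f⟩ := nonempty_iso_directSum_restrict (K := K) e e.injective Q
    (fun k hk => absurd (e.surjective k) hk) (fun k hk => absurd (e.surjective k) hk)
  exact ⟨(Iso.directSum fun i => (h i).some).trans f.symm⟩

/-- Bases that the two pairs map to each other in the same way yield an isomorphism. -/
noncomputable def Iso.ofBases {π : TsfPair.{u, v} K} {π' : TsfPair.{u, w} K}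
    {ι : Type w₁} {κ : Type w₂} (a b : ι → κ)
    (bE : Module.Basis ι K π.E) (bE' : Module.Basis ι K π'.E)
    (bV : Module.Basis κ K π.V) (bV' : Module.Basis κ K π'.V)
    (hμ : ∀ i, π.μ (bE i) = bV (a i)) (hμ' : ∀ i, π'.μ (bE' i) = bV' (a i))
    (hν : ∀ i, π.ν (bE i) = bV (b i)) (hν' : ∀ i, π'.ν (bE' i) = bV' (b i)) : Iso π π' where
  α := bE.equiv bE' (Equiv.refl ι)
  β := bV.equiv bV' (Equiv.refl κ)
  comm_μ x := by
    have h : π'.μ ∘ₗ (bE.equiv bE' (Equiv.refl ι)).toLinearMap =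
        (bV.equiv bV' (Equiv.refl κ)).toLinearMap ∘ₗ π.μ :=
      bE.ext fun i => by simp [hμ, hμ']
    exact LinearMap.congr_fun h x
  comm_ν x := by
    have h : π'.ν ∘ₗ (bE.equiv bE' (Equiv.refl ι)).toLinearMap =
        (bV.equiv bV' (Equiv.refl κ)).toLinearMap ∘ₗ π.ν :=
      bE.ext fun i => by simp [hν, hν']
    exact LinearMap.congr_fun h x

/-! ### Contractions of transformation-pairs -/

/-- A left contraction of `π` onto `ρ`: it identifies `ρ` with `[E/ker μ → V/ν(ker μ)]`. -/
structure LeftContraction (π : TsfPair.{u, v} K) (ρ : TsfPair.{u, w} K) where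
  f : π.E →ₗ[K] ρ.E
  g : π.V →ₗ[K] ρ.V
  comm_μ : ∀ x, ρ.μ (f x) = g (π.μ x)
  comm_ν : ∀ x, ρ.ν (f x) = g (π.ν x)
  surj_f : Function.Surjective f
  surj_g : Function.Surjective g
  ker_f : LinearMap.ker f = LinearMap.ker π.μ
  ker_g : LinearMap.ker g = (LinearMap.ker π.μ).map π.ν

namespace LeftContraction

variable {π : TsfPair.{u, v} K} {π' : TsfPair.{u, v₁} K} {ρ : TsfPair.{u, w} K}

/-- A left contraction may be followed by an isomorphism. -/
def transIso (c : LeftContraction π ρ) (e : Iso ρ π') : LeftContraction π π' where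
  f := e.α.toLinearMap ∘ₗ c.f
  g := e.β.toLinearMap ∘ₗ c.g
  comm_μ x := by simp [e.comm_μ, c.comm_μ]
  comm_ν x := by simp [e.comm_ν, c.comm_ν]
  surj_f := e.α.surjective.comp c.surj_f
  surj_g := e.β.surjective.comp c.surj_g
  ker_f := by rw [LinearEquiv.ker_comp, c.ker_f]
  ker_g := by rw [LinearEquiv.ker_comp, c.ker_g]

theorem mem_ker_f (c : LeftContraction π ρ) {x : π.E} : c.f x = 0 ↔ π.μ x = 0 := by
  rw [← LinearMap.mem_ker, c.ker_f, LinearMap.mem_ker]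

theorem mem_ker_g (c : LeftContraction π ρ) {y : π.V} :
    c.g y = 0 ↔ ∃ x, π.μ x = 0 ∧ π.ν x = y := by
  rw [← LinearMap.mem_ker, c.ker_g, Submodule.mem_map]
  rfl

/-- Sections of a left contraction that commute with `ν`, and with `μ` up to a map that factors
through the projection onto `ker μ` given by the generalized inverse `q`. -/
theorem exists_section (c : LeftContraction π ρ) (q : ρ.V →ₗ[K] ρ.E)
    (hq : ∀ x, ρ.μ (q (ρ.μ x)) = ρ.μ x) :
    ∃ (s : ρ.E →ₗ[K] π.E) (t : ρ.V →ₗ[K] π.V), (∀ x, c.f (s x) = x) ∧ (∀ y, c.g (t y) = y) ∧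
      (∀ x, π.ν (s x) = t (ρ.ν x)) ∧ (∀ x, π.μ (s (q (ρ.μ x))) = t (ρ.μ x)) := by
  obtain ⟨s, hs⟩ := c.f.exists_rightInverse_of_surjective (LinearMap.range_eq_top.2 c.surj_f)
  obtain ⟨t₀, ht₀⟩ := c.g.exists_rightInverse_of_surjective (LinearMap.range_eq_top.2 c.surj_g)
  replace hs : ∀ x, c.f (s x) = x := fun x => LinearMap.congr_fun hs x
  replace ht₀ : ∀ x, c.g (t₀ x) = x := fun x => LinearMap.congr_fun ht₀ x
  -- The correction of `t₀` takes values in `ker g`, and it makes `t` agree with `μ ∘ s ∘ q` on the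
  -- range of `ρ.μ`, where `ρ.μ ∘ q` is the identity.
  let t : ρ.V →ₗ[K] π.V := t₀ + (π.μ ∘ₗ s - t₀ ∘ₗ ρ.μ) ∘ₗ q
  have ht : ∀ y, c.g (t y) = y := by
    intro y
    simp [t, ht₀, ← c.comm_μ, hs]
  have htq : ∀ x, π.μ (s (q (ρ.μ x))) = t (ρ.μ x) := by
    intro x
    simp [t, hq]
  have hmap : ∀ x ∈ LinearMap.ker π.μ, π.ν x ∈ LinearMap.ker c.g := fun x hx => by
    rw [c.ker_g]
    exact Submodule.mem_map_of_mem hx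
  let ν₁ : LinearMap.ker π.μ →ₗ[K] LinearMap.ker c.g := π.ν.restrict hmap
  have hν₁ : Function.Surjective ν₁ := by
    rintro ⟨y, hy⟩
    obtain ⟨x, hx, rfl⟩ := c.mem_ker_g.1 hy
    exact ⟨⟨x, hx⟩, rfl⟩
  obtain ⟨r, hr⟩ := ν₁.exists_rightInverse_of_surjective (LinearMap.range_eq_top.2 hν₁)
  let d : ρ.E →ₗ[K] LinearMap.ker c.g := (π.ν ∘ₗ s - t ∘ₗ ρ.ν).codRestrict _ fun x => by
    simp [ht, ← c.comm_ν, hs]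
  -- Since `ν` maps `ker μ` onto `ker g`, the defect `d` of `ν` can be absorbed by vectors of `ker
  -- μ`. This leaves `μ ∘ s` unchanged, so `htq` survives.
  let s' : ρ.E →ₗ[K] π.E := s - (LinearMap.ker π.μ).subtype ∘ₗ r ∘ₗ d
  have hμr : ∀ y, π.μ (r y : π.E) = 0 := fun y => (r y).2
  have hνr : ∀ y, π.ν (r y : π.E) = y := fun y => congrArg Subtype.val (LinearMap.congr_fun hr y)
  refine ⟨s', t, ?_, ht, ?_, ?_⟩
  · intro x
    have h : c.f (r (d x) : π.E) = 0 := c.mem_ker_f.2 (hμr _)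
    simp [s', hs, h]
  · intro x
    simp [s', hνr, d]
  · intro x
    simp [s', hμr, htq]

theorem finrank_E (c : LeftContraction π ρ) : Module.finrank K π.E =
    Module.finrank K ρ.E + Module.finrank K (LinearMap.ker c.f) := by
  have := c.f.finrank_range_add_finrank_ker
  rw [LinearMap.range_eq_top.2 c.surj_f, finrank_top] at this
  exact this.symm

theorem finrank_V (c : LeftContraction π ρ) : Module.finrank K π.V =
    Module.finrank K ρ.V + Module.finrank K (LinearMap.ker c.g) := by
  have := c.g.finrank_range_add_finrank_ker
  rw [LinearMap.range_eq_top.2 c.surj_g, finrank_top] at this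
  exact this.symm

/-- A section of `μ` over its range, extended to all of `V`. A single `q` is used for two pairs with
the same contraction, so that their sections are normalized alike. -/
theorem exists_generalizedInverse (ρ : TsfPair.{u, w} K) :
    ∃ q : ρ.V →ₗ[K] ρ.E, ∀ x, ρ.μ (q (ρ.μ x)) = ρ.μ x := by
  obtain ⟨r, hr⟩ := ρ.μ.rangeRestrict.exists_rightInverse_of_surjective ρ.μ.range_rangeRestrict
  obtain ⟨q, hq⟩ := r.exists_extend
  refine ⟨q, fun x => ?_⟩
  have h1 : q (ρ.μ x) = r (ρ.μ.rangeRestrict x) := LinearMap.congr_fun hq (ρ.μ.rangeRestrict x)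
  rw [h1]
  exact congrArg Subtype.val (LinearMap.congr_fun hr (ρ.μ.rangeRestrict x))

/-- A transformation-pair is determined by its left contraction and its dimensions. -/
theorem nonempty_iso (c : LeftContraction π ρ) (c' : LeftContraction π' ρ)
    (hE : Module.finrank K π.E = Module.finrank K π'.E)
    (hV : Module.finrank K π.V = Module.finrank K π'.V) : Nonempty (Iso π π') := by
  obtain ⟨q, hq⟩ := exists_generalizedInverse ρ
  obtain ⟨s, t, hs, ht, hνs, hqs⟩ := c.exists_section q hq
  obtain ⟨s', t', hs', ht', hνs', hqs'⟩ := c'.exists_section q hq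
  let φ : ρ.E →ₗ[K] LinearMap.ker c.g := (π.μ ∘ₗ s - t ∘ₗ ρ.μ).codRestrict _ fun x => by
    simp [ht, ← c.comm_μ, hs]
  let φ' : ρ.E →ₗ[K] LinearMap.ker c'.g := (π'.μ ∘ₗ s' - t' ∘ₗ ρ.μ).codRestrict _ fun x => by
    simp [ht', ← c'.comm_μ, hs']
  -- The defect `φ` of `μ` satisfies `φ x = μ (s (x - q (ρ.μ x)))` by the choice of `t`. Hence its
  -- kernel depends only on `ρ` and `q`, and is the same for `π` and `π'`.
  have hφ : ∀ x, φ x = 0 ↔ x = q (ρ.μ x) := by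
    intro x
    rw [← sub_eq_zero (a := x), ← hs (x - _), c.mem_ker_f, ← Subtype.coe_inj]
    simp [φ, hqs]
  have hφ' : ∀ x, φ' x = 0 ↔ x = q (ρ.μ x) := by
    intro x
    rw [← sub_eq_zero (a := x), ← hs' (x - _), c'.mem_ker_f, ← Subtype.coe_inj]
    simp [φ', hqs']
  have dE := c.finrank_E
  have dE' := c'.finrank_E
  have dV := c.finrank_V
  have dV' := c'.finrank_V
  -- `β` identifies the two defects; `α` will then cover `β` along the surjections `ν : ker f → ker
  -- g`.
  obtain ⟨β, hβ⟩ := LinearMap.exists_equiv_comp_eq_of_ker_eq φ φ'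
    (by ext x; rw [LinearMap.mem_ker, LinearMap.mem_ker, hφ, hφ']) (by omega)
  have hn : ∀ x ∈ LinearMap.ker c.f, π.ν x ∈ LinearMap.ker c.g := fun x hx => by
    rw [LinearMap.mem_ker, ← c.comm_ν, LinearMap.mem_ker.1 hx, map_zero]
  have hn' : ∀ x ∈ LinearMap.ker c'.f, π'.ν x ∈ LinearMap.ker c'.g := fun x hx => by
    rw [LinearMap.mem_ker, ← c'.comm_ν, LinearMap.mem_ker.1 hx, map_zero]
  obtain ⟨α, hα⟩ := LinearMap.exists_equiv_lift_of_surjective (π.ν.restrict hn) (π'.ν.restrict hn')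
    (by
      rintro ⟨y, hy⟩
      obtain ⟨x, hx, rfl⟩ := c.mem_ker_g.1 hy
      exact ⟨⟨x, c.mem_ker_f.2 hx⟩, rfl⟩)
    (by
      rintro ⟨y, hy⟩
      obtain ⟨x, hx, rfl⟩ := c'.mem_ker_g.1 hy
      exact ⟨⟨x, c'.mem_ker_f.2 hx⟩, rfl⟩) β (by omega)
  let kE : π.E →ₗ[K] LinearMap.ker c.f := (LinearMap.id - s ∘ₗ c.f).codRestrict _ fun x => by
    simp [hs]
  let kV : π.V →ₗ[K] LinearMap.ker c.g := (LinearMap.id - t ∘ₗ c.g).codRestrict _ fun x => by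
    simp [ht]
  -- With `E = s(ρ.E) ⊕ ker f` and `V = t(ρ.V) ⊕ ker g`, sections are matched with sections, and
  -- `α`, `β` act on the kernels.
  let a : π.E →ₗ[K] π'.E :=
    s' ∘ₗ c.f + (LinearMap.ker c'.f).subtype ∘ₗ α.toLinearMap ∘ₗ kE
  let b : π.V →ₗ[K] π'.V :=
    t' ∘ₗ c.g + (LinearMap.ker c'.g).subtype ∘ₗ β.toLinearMap ∘ₗ kV
  have ha : ∀ x, a x = s' (c.f x) + (α (kE x) : π'.E) := fun _ => rfl
  have hb : ∀ x, b x = t' (c.g x) + (β (kV x) : π'.V) := fun _ => rfl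
  have inj_a : Function.Injective a := by
    rw [← LinearMap.ker_eq_bot, LinearMap.ker_eq_bot']
    intro x hx
    have h0 : c'.f (α (kE x) : π'.E) = 0 := (α (kE x)).2
    have h1 : c.f x = 0 := by
      have := congrArg c'.f hx
      simpa [ha, hs', h0] using this
    have h2 : α (kE x) = 0 := by
      refine Subtype.ext ?_
      simpa [ha, h1] using hx
    have h3 : x - s (c.f x) = 0 := congrArg Subtype.val ((LinearEquiv.map_eq_zero_iff α).1 h2)
    simpa [h1] using h3
  have inj_b : Function.Injective b := by
    rw [← LinearMap.ker_eq_bot, LinearMap.ker_eq_bot']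
    intro x hx
    have h0 : c'.g (β (kV x) : π'.V) = 0 := (β (kV x)).2
    have h1 : c.g x = 0 := by
      have := congrArg c'.g hx
      simpa [hb, ht', h0] using this
    have h2 : β (kV x) = 0 := by
      refine Subtype.ext ?_
      simpa [hb, h1] using hx
    have h3 : x - t (c.g x) = 0 := congrArg Subtype.val ((LinearEquiv.map_eq_zero_iff β).1 h2)
    simpa [h1] using h3
  refine ⟨⟨LinearEquiv.ofInjectiveOfFinrankEq a inj_a hE,
    LinearEquiv.ofInjectiveOfFinrankEq b inj_b hV, fun x => ?_, fun x => ?_⟩⟩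
  · change π'.μ (a x) = b (π.μ x)
    have h0 : π'.μ (α (kE x) : π'.E) = 0 := c'.mem_ker_f.1 (α (kE x)).2
    -- As `x - s (f x)` lies in `ker μ`, the component of `μ x` in `ker g` is exactly the defect at
    -- `f x`, which `β` carries to `φ'`.
    have h1 : kV (π.μ x) = φ (c.f x) := by
      refine Subtype.ext ?_
      have h2 : π.μ (x - s (c.f x)) = 0 := c.mem_ker_f.1 (kE x).2
      change π.μ x - t (c.g (π.μ x)) = π.μ (s (c.f x)) - t (ρ.μ (c.f x))
      rw [c.comm_μ, sub_left_inj, ← sub_eq_zero, ← map_sub, h2]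
    rw [ha, hb, map_add, h0, h1, hβ, ← c.comm_μ]
    simp [φ']
  · change π'.ν (a x) = b (π.ν x)
    have h1 : kV (π.ν x) = π.ν.restrict hn (kE x) := by
      refine Subtype.ext ?_
      change π.ν x - t (c.g (π.ν x)) = π.ν (x - s (c.f x))
      rw [map_sub, hνs, c.comm_ν]
    rw [ha, hb, map_add, hνs', h1, ← hα, c.comm_ν]
    rfl

end LeftContraction

end TsfPair

/-! ### Dimension counts for left contractions -/

namespace TsfPair

variable {K : Type u} [Field K]

namespace LeftContraction

/-- A left contraction is tight if `π` has no summands `⁰T_0⁰` and `⁰T_1`. -/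
structure Tight (π : TsfPair.{u, v} K) : Prop where
  inj : ∀ x, π.μ x = 0 → π.ν x = 0 → x = 0
  mem_range : ∀ x, π.μ x = 0 → ∃ z, π.μ z = π.ν x

theorem Tight.of_injective {π : TsfPair.{u, v} K} (h : Function.Injective π.μ) : Tight π where
  inj x hx _ := h (hx.trans (map_zero _).symm)
  mem_range x hx := ⟨0, by rw [h (hx.trans (map_zero _).symm), map_zero, map_zero]⟩

theorem Tight.directSum {ι : Type w} [Finite ι] {Q : ι → TsfPair.{u, v} K}
    (h : ∀ i, Tight (Q i)) : Tight (directSum Q) where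
  inj x hx hy := funext fun i => (h i).inj (x i) (congrFun hx i) (congrFun hy i)
  mem_range x hx := by
    choose z hz using fun i => (h i).mem_range (x i) (congrFun hx i)
    exact ⟨z, funext hz⟩

variable {π : TsfPair.{u, v} K} {π' : TsfPair.{u, v₁} K} {ρ : TsfPair.{u, w} K}

theorem finrank_ker_g_le (c : LeftContraction π ρ) :
    Module.finrank K (LinearMap.ker c.g) ≤ Module.finrank K (LinearMap.ker c.f) := by
  rw [c.ker_g, c.ker_f]
  exact Submodule.finrank_map_le _ _

/-- If `s` is a section of `f`, then `μ ∘ s` embeds `ker ρ.μ` into `ker g`: its kernel is trivial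
because `ker μ = ker f`. -/
theorem finrank_ker_μ_le (c : LeftContraction π ρ) :
    Module.finrank K (LinearMap.ker ρ.μ) ≤ Module.finrank K (LinearMap.ker c.g) := by
  obtain ⟨s, hs⟩ := c.f.exists_rightInverse_of_surjective (LinearMap.range_eq_top.2 c.surj_f)
  replace hs : ∀ x, c.f (s x) = x := fun x => LinearMap.congr_fun hs x
  refine LinearMap.finrank_le_finrank_of_injective
    (f := (π.μ ∘ₗ s).restrict (p := LinearMap.ker ρ.μ) (q := LinearMap.ker c.g) fun x hx => ?_) ?_
  · simp only [LinearMap.mem_ker, LinearMap.comp_apply] at hx ⊢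
    rw [← c.comm_μ, hs, hx]
  · rw [← LinearMap.ker_eq_bot, LinearMap.ker_eq_bot']
    rintro ⟨x, hx⟩ h
    have h1 : π.μ (s x) = 0 := congrArg Subtype.val h
    rw [← c.mem_ker_f, hs] at h1
    exact Subtype.ext h1

/-- By tightness `ν` is injective on `ker μ`, so it maps `ker f = ker μ` isomorphically onto `ker
g`. -/
theorem Tight.finrank_ker_f (h : Tight π) (c : LeftContraction π ρ) :
    Module.finrank K (LinearMap.ker c.f) = Module.finrank K (LinearMap.ker c.g) := by
  rw [c.ker_g, c.ker_f]
  refine LinearEquiv.finrank_eq (LinearEquiv.ofBijective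
    (π.ν.restrict fun x hx => Submodule.mem_map_of_mem hx) ⟨?_, ?_⟩)
  · rw [← LinearMap.ker_eq_bot, LinearMap.ker_eq_bot']
    rintro ⟨x, hx⟩ h1
    exact Subtype.ext (h.inj x hx (congrArg Subtype.val h1))
  · rintro ⟨y, x, hx, rfl⟩
    exact ⟨⟨x, hx⟩, rfl⟩

/-- The embedding of `finrank_ker_μ_le` becomes onto: every vector of `ker g = ν(ker μ)` is some `μ
z`, and then `f z` lies in `ker ρ.μ`. So a tight pair has the least possible dimensions over its
contraction. -/
theorem Tight.finrank_ker_g (h : Tight π) (c : LeftContraction π ρ) :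
    Module.finrank K (LinearMap.ker c.g) ≤ Module.finrank K (LinearMap.ker ρ.μ) := by
  obtain ⟨s, hs⟩ := c.f.exists_rightInverse_of_surjective (LinearMap.range_eq_top.2 c.surj_f)
  replace hs : ∀ x, c.f (s x) = x := fun x => LinearMap.congr_fun hs x
  refine LinearMap.finrank_le_finrank_of_surjective
    (f := (π.μ ∘ₗ s).restrict (p := LinearMap.ker ρ.μ) (q := LinearMap.ker c.g) fun x hx => ?_) ?_
  · simp only [LinearMap.mem_ker, LinearMap.comp_apply] at hx ⊢
    rw [← c.comm_μ, hs, hx]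
  · rintro ⟨y, hy⟩
    obtain ⟨x, hx, rfl⟩ := c.mem_ker_g.1 hy
    obtain ⟨z, hz⟩ := h.mem_range x hx
    refine ⟨⟨c.f z, ?_⟩, Subtype.ext ?_⟩
    · rw [LinearMap.mem_ker, c.comm_μ, hz]
      exact hy
    · change π.μ (s (c.f z)) = π.ν x
      rw [← hz, ← sub_eq_zero, ← map_sub, ← c.mem_ker_f, map_sub, hs, sub_self]

/-- The identity is a left contraction if `μ` is injective. -/
def ofInjective (h : Function.Injective π.μ) : LeftContraction π π where
  f := LinearMap.id
  g := LinearMap.id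
  comm_μ _ := rfl
  comm_ν _ := rfl
  surj_f := Function.surjective_id
  surj_g := Function.surjective_id
  ker_f := by rw [LinearMap.ker_id, LinearMap.ker_eq_bot.2 h]
  ker_g := by rw [LinearMap.ker_id, LinearMap.ker_eq_bot.2 h, Submodule.map_bot]

/-- Left contraction of a direct sum some of whose summands, having `μ = 0` and `ν` surjective, are
contracted to zero. -/
def directSum {ι : Type w₁} {κ : Type w₂} [Finite ι] [Finite κ]
    {P : ι → TsfPair.{u, w} K} {Q : ι ⊕ κ → TsfPair.{u, v} K}
    (c : ∀ i, LeftContraction (Q (Sum.inl i)) (P i)) (hμ : ∀ j x, (Q (Sum.inr j)).μ x = 0)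
    (hν : ∀ j, Function.Surjective (Q (Sum.inr j)).ν) :
    LeftContraction (TsfPair.directSum Q) (TsfPair.directSum P) where
  f := (LinearMap.pi fun i => (c i).f ∘ₗ LinearMap.proj (Sum.inl i) :
    (∀ k, (Q k).E) →ₗ[K] ∀ i, (P i).E)
  g := (LinearMap.pi fun i => (c i).g ∘ₗ LinearMap.proj (Sum.inl i) :
    (∀ k, (Q k).V) →ₗ[K] ∀ i, (P i).V)
  comm_μ x := funext fun i => (c i).comm_μ (x (Sum.inl i))
  comm_ν x := funext fun i => (c i).comm_ν (x (Sum.inl i))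
  surj_f y := by
    choose x hx using fun i => (c i).surj_f ((y : ∀ i, (P i).E) i)
    exact ⟨fun k => match k with
      | Sum.inl i => x i
      | Sum.inr j => (0 : (Q (Sum.inr j)).E), funext hx⟩
  surj_g y := by
    choose x hx using fun i => (c i).surj_g ((y : ∀ i, (P i).V) i)
    exact ⟨fun k => match k with
      | Sum.inl i => x i
      | Sum.inr j => (0 : (Q (Sum.inr j)).V), funext hx⟩
  ker_f := by
    ext x
    constructor
    · intro hx
      refine funext fun k => ?_
      rcases k with i | j
      · exact (c i).mem_ker_f.1 (congrFun hx i)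
      · exact hμ j _
    · intro hx
      exact funext fun i => (c i).mem_ker_f.2 (congrFun hx (Sum.inl i))
  ker_g := by
    ext y
    constructor
    · intro hy
      choose x hx hxy using fun i => (c i).mem_ker_g.1 (congrFun hy i)
      choose z hz using fun j => hν j (y (Sum.inr j))
      refine ⟨fun k => match k with
        | Sum.inl i => x i
        | Sum.inr j => z j, funext fun k => ?_, funext fun k => ?_⟩
      · rcases k with i | j
        · exact hx i
        · exact hμ j _
      · rcases k with i | j
        · exact hxy i
        · exact hz j
    · rintro ⟨x, hx, rfl⟩
      exact funext fun i => (c i).mem_ker_g.2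
        ⟨x (Sum.inl i), congrFun hx (Sum.inl i), rfl⟩

/-- The left contraction `[E/ker μ → V/ν(ker μ)]`. -/
def quot (π : TsfPair.{u, v} K) : TsfPair.{u, v} K where
  E := π.E ⧸ LinearMap.ker π.μ
  V := π.V ⧸ (LinearMap.ker π.μ).map π.ν
  μ := (LinearMap.ker π.μ).liftQ (Submodule.mkQ _ ∘ₗ π.μ) fun x hx => by
    simp [LinearMap.mem_ker.1 hx]
  ν := (LinearMap.ker π.μ).mapQ _ π.ν (Submodule.le_comap_map _ _)

/-- The projection onto the left contraction. -/
def toQuot (π : TsfPair.{u, v} K) : LeftContraction π (quot π) where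
  f := Submodule.mkQ _
  g := Submodule.mkQ _
  comm_μ _ := rfl
  comm_ν _ := rfl
  surj_f := Submodule.mkQ_surjective _
  surj_g := Submodule.mkQ_surjective _
  ker_f := Submodule.ker_mkQ _
  ker_g := Submodule.ker_mkQ _

end LeftContraction

/-- The dimension of `E`. -/
noncomputable def dimE (π : TsfPair.{u, v} K) : ℕ := Module.finrank K π.E

/-- The dimension of `V`. -/
noncomputable def dimV (π : TsfPair.{u, v} K) : ℕ := Module.finrank K π.V

theorem finrank_directSum_E {ι : Type w} [Fintype ι] (P : ι → TsfPair.{u, v} K) :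
    Module.finrank K (directSum P).E = ∑ i, (P i).dimE :=
  Module.finrank_pi_fintype K

theorem finrank_directSum_V {ι : Type w} [Fintype ι] (P : ι → TsfPair.{u, v} K) :
    Module.finrank K (directSum P).V = ∑ i, (P i).dimV :=
  Module.finrank_pi_fintype K

/-! ### Coordinates and left contractions of the Kronecker types -/

theorem ofBasis_apply (K : Type u) [Field K] {n m : ℕ} (f : Fin n → Fin m → K) (x : Fin n → K) :
    ofBasis K f x = ∑ i, x i • f i := by
  simp [ofBasis, Module.Basis.constr_apply_fintype]

theorem nilp_zero (n : ℕ) (x : Fin (n + 1) → K) : nilp K (n + 1) x 0 = 0 := by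
  rw [nilp, ofBasis_apply, Finset.sum_apply]
  refine Finset.sum_eq_zero fun i _ => ?_
  split_ifs with h
  · have h0 : (0 : Fin (n + 1)) ≠ ⟨i + 1, h⟩ := fun h0 => by
      have := congrArg Fin.val h0
      simp at this
    simp
  · simp

theorem nilp_succ (n : ℕ) (x : Fin (n + 1) → K) (j : Fin n) :
    nilp K (n + 1) x j.succ = x j.castSucc := by
  rw [nilp, ofBasis_apply, Finset.sum_apply, Finset.sum_eq_single j.castSucc]
  · have h : ((j.castSucc : Fin (n + 1)) : ℕ) + 1 < n + 1 := by simp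
    have h' : (⟨(j.castSucc : Fin (n + 1)) + 1, h⟩ : Fin (n + 1)) = j.succ := by
      simp [Fin.ext_iff]
    rw [dif_pos h, h']
    simp
  · intro i _ hi
    split_ifs with h
    · have : j.succ ≠ ⟨i + 1, h⟩ := by
        intro h1
        apply hi
        simp only [Fin.ext_iff, Fin.val_succ, Fin.val_castSucc] at h1 ⊢
        omega
      simp [this]
    · simp
  · simp

theorem tType_μ_castSucc (n : ℕ) (x : Fin n → K) (j : Fin n) :
    (tType K n).μ x j.castSucc = x j := by
  change ofBasis K _ x _ = _
  rw [ofBasis_apply, Finset.sum_apply, Finset.sum_eq_single j]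
  · simp
  · intro i _ hi
    simp [hi.symm]
  · simp

theorem tType_μ_last (n : ℕ) (x : Fin n → K) : (tType K n).μ x (Fin.last n) = 0 := by
  change ofBasis K _ x _ = _
  rw [ofBasis_apply, Finset.sum_apply]
  refine Finset.sum_eq_zero fun i _ => ?_
  simp [(Fin.castSucc_lt_last i).ne']

theorem tType_ν_succ (n : ℕ) (x : Fin n → K) (j : Fin n) :
    (tType K n).ν x j.succ = x j := by
  change ofBasis K _ x _ = _
  rw [ofBasis_apply, Finset.sum_apply, Finset.sum_eq_single j]
  · simp
  · intro i _ hi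
    simp [hi.symm]
  · simp

theorem tType_ν_zero (n : ℕ) (x : Fin n → K) : (tType K n).ν x 0 = 0 := by
  change ofBasis K _ x _ = _
  rw [ofBasis_apply, Finset.sum_apply]
  refine Finset.sum_eq_zero fun i _ => ?_
  simp [(Fin.succ_ne_zero i).symm]

theorem zeroTZero_μ (n : ℕ) (x : Fin (n + 1) → K) (j : Fin n) :
    (zeroTZero K n).μ x j = x j.castSucc := by
  change ofBasis K _ x _ = _
  rw [ofBasis_apply, Finset.sum_apply, Fin.sum_univ_castSucc, Finset.sum_eq_single j]
  · simp
  · intro i _ hi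
    simp [hi.symm]
  · simp

theorem zeroTZero_ν (n : ℕ) (x : Fin (n + 1) → K) (j : Fin n) :
    (zeroTZero K n).ν x j = x j.succ := by
  change ofBasis K _ x _ = _
  rw [ofBasis_apply, Finset.sum_apply, Fin.sum_univ_succ, Finset.sum_eq_single j]
  · simp
  · intro i _ hi
    simp [hi.symm]
  · simp

theorem tType_μ_injective (n : ℕ) : Function.Injective (tType K n).μ := fun x y h =>
  funext fun j => (tType_μ_castSucc n x j).symm.trans
    ((congrFun h j.castSucc).trans (tType_μ_castSucc n y j))

theorem tType_ν_injective (n : ℕ) : Function.Injective (tType K n).ν := fun x y h =>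
  funext fun j => (tType_ν_succ n x j).symm.trans
    ((congrFun h j.succ).trans (tType_ν_succ n y j))

/-- Reversing the standard bases exchanges the two maps of `⁰T_n⁰`. -/
def zeroTZeroSwap (n : ℕ) : Iso (zeroTZero K n).swap (zeroTZero K n) where
  α := LinearEquiv.funCongrLeft K K Fin.revPerm
  β := LinearEquiv.funCongrLeft K K Fin.revPerm
  comm_μ x := funext fun j =>
    (zeroTZero_μ n (fun i => x i.rev) j).trans
      ((congrArg x (Fin.rev_castSucc j)).trans (zeroTZero_ν n x j.rev).symm)
  comm_ν x := funext fun j =>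
    (zeroTZero_ν n (fun i => x i.rev) j).trans
      ((congrArg x (Fin.rev_succ j)).trans (zeroTZero_μ n x j.rev).symm)

/-- Restriction to the first `n` coordinates of `K^{n+1}`. -/
def dropLast (K : Type u) [Field K] (n : ℕ) : (Fin (n + 1) → K) →ₗ[K] (Fin n → K) :=
  LinearMap.funLeft K K Fin.castSucc

theorem dropLast_surjective (n : ℕ) : Function.Surjective (dropLast K n) :=
  LinearMap.funLeft_surjective_of_injective _ _ _ (Fin.castSucc_injective n)

theorem ker_dropLast (n : ℕ) : LinearMap.ker (dropLast K n) = LinearMap.ker (nilp K (n + 1)) := by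
  ext x
  rw [LinearMap.mem_ker, LinearMap.mem_ker]
  constructor
  · intro h
    funext j
    cases j using Fin.cases with
    | zero => exact nilp_zero n x
    | succ j => exact (nilp_succ n x j).trans (congrFun h j)
  · intro h
    funext j
    exact (nilp_succ n x j).symm.trans (congrFun h j.succ)

/-- The left contraction of `⁰T_{n+2}` is `⁰T_{n+1}`. -/
def zeroTContraction (n : ℕ) : LeftContraction (zeroT K (n + 2)) (zeroT K (n + 1)) where
  f := dropLast K (n + 1)
  g := dropLast K (n + 1)
  comm_μ x := funext fun j => by
    cases j using Fin.cases with
    | zero => exact (nilp_zero n (dropLast K (n + 1) x)).trans (nilp_zero (n + 1) x).symm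
    | succ j =>
      exact (nilp_succ n (dropLast K (n + 1) x) j).trans (nilp_succ (n + 1) x j.castSucc).symm
  comm_ν _ := rfl
  surj_f := dropLast_surjective _
  surj_g := dropLast_surjective _
  ker_f := ker_dropLast _
  ker_g := (ker_dropLast _).trans (Submodule.map_id _).symm

/-- A vector killed by the shift is concentrated in its last coordinate. As there are at least two
coordinates, the first one vanishes, and shifting back gives a preimage. -/
theorem zeroT_tight (n : ℕ) : LeftContraction.Tight (zeroT K (n + 2)) where
  inj _ _ h := h
  mem_range x hx := by
    refine ⟨Fin.snoc (fun j => x j.succ) (0 : K), funext fun j => ?_⟩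
    change nilp K (n + 2) _ j = x j
    cases j using Fin.cases with
    | zero =>
      rw [nilp_zero]
      exact ((nilp_succ (n + 1) x 0).symm.trans (congrFun hx _)).symm
    | succ j =>
      rw [nilp_succ]
      simp

/-- The left contraction of `⁰T_{n+1}⁰` is `⁰T_n⁰`. -/
def zeroTZeroContraction (n : ℕ) :
    LeftContraction (zeroTZero K (n + 1)) (zeroTZero K n) where
  f := dropLast K (n + 1)
  g := dropLast K n
  comm_μ x := funext fun j => (zeroTZero_μ n (dropLast K (n + 1) x) j).trans
    (zeroTZero_μ (n + 1) x j.castSucc).symm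
  comm_ν x := funext fun j => (zeroTZero_ν n (dropLast K (n + 1) x) j).trans
    (zeroTZero_ν (n + 1) x j.castSucc).symm
  surj_f := dropLast_surjective _
  surj_g := dropLast_surjective _
  ker_f := by
    congr 1
    exact LinearMap.ext fun x => funext fun j => (zeroTZero_μ _ x j).symm
  ker_g := by
    ext y
    constructor
    · intro hy
      let z : Fin (n + 1) → K := y
      have hz : ∀ j : Fin n, z j.castSucc = 0 := fun j => congrFun hy j
      -- Prepending `0` gives a preimage under `ν`, which drops the first coordinate; `μ` drops the
      -- last one, the only coordinate of `z` that may be nonzero.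
      refine ⟨(Fin.cons (0 : K) z : Fin (n + 2) → K), funext fun j => ?_, funext fun j => ?_⟩
      · refine (zeroTZero_μ (n + 1) _ j).trans ?_
        cases j using Fin.cases with
        | zero => rfl
        | succ j => exact hz j
      · exact zeroTZero_ν (n + 1) _ j
    · rintro ⟨x, hx, rfl⟩
      exact funext fun j => (zeroTZero_ν (n + 1) x j.castSucc).trans
        ((zeroTZero_μ (n + 1) x j.succ).symm.trans (congrFun hx j.succ))

/-- With at least two coordinates in the domain, the maps dropping the last and the first coordinate
together see all of them; moreover `μ` is surjective. -/
theorem zeroTZero_tight (n : ℕ) : LeftContraction.Tight (zeroTZero K (n + 1)) where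
  inj x h h' := by
    funext j
    cases j using Fin.cases with
    | zero => exact (zeroTZero_μ _ x 0).symm.trans (congrFun h 0)
    | succ j => exact (zeroTZero_ν _ x j).symm.trans (congrFun h' j)
  mem_range x _ := by
    let y : Fin (n + 1) → K := (zeroTZero K (n + 1)).ν x
    refine ⟨(Fin.snoc y (0 : K) : Fin (n + 2) → K), funext fun j => ?_⟩
    exact (zeroTZero_μ (n + 1) _ j).trans (Fin.snoc_castSucc (α := fun _ => K) _ y j)

end TsfPair

/-! ### Lifting decompositions along contractions and null extensions -/

namespace TsfPair

variable {K : Type u} [Field K]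

/-- Summands of `π` are obtained by lifting the summands of a left contraction of `π`, and adding
copies of `⁰T_1` and `⁰T_0⁰`. -/
theorem LeftContraction.exists_lift {π : TsfPair.{u, v} K} {ρ : TsfPair.{u, w} K} {ι : Type w₁}
    [Finite ι] {P : ι → TsfPair.{u, v₁} K} {Q : ι → TsfPair.{u, u} K}
    (c : ∀ i, LeftContraction (Q i) (P i)) (t : ∀ i, Tight (Q i))
    (d : LeftContraction π ρ) (e : Iso ρ (TsfPair.directSum P)) :
    ∃ a b : ℕ, Nonempty (Iso π (TsfPair.directSum (Sum.elim Q (Sum.elim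
      (fun _ : Fin a => zeroT K 1) (fun _ : Fin b => zeroTZero K 0))))) := by
  have := Fintype.ofFinite ι
  let d' := d.transIso e
  -- The empty second family makes the contraction of a direct sum available with no summand
  -- contracted to zero.
  let Q₀ : ι ⊕ PEmpty.{1} → TsfPair.{u, u} K := Sum.elim Q PEmpty.elim
  have t₀ : Tight (TsfPair.directSum Q₀) := Tight.directSum fun k => by
    rcases k with i | j
    · exact t i
    · exact j.elim
  let c₀ : LeftContraction (TsfPair.directSum Q₀) (TsfPair.directSum P) :=
    LeftContraction.directSum c (fun j => j.elim) (fun j => j.elim)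
  have h1 := c₀.finrank_E
  have h2 := c₀.finrank_V
  have h3 := t₀.finrank_ker_f c₀
  have h4 := t₀.finrank_ker_g c₀
  have h5 := d'.finrank_E
  have h6 := d'.finrank_V
  have h7 := d'.finrank_ker_g_le
  have h8 := d'.finrank_ker_μ_le
  have hE : ∑ k, (Q₀ k).dimE = ∑ i, (Q i).dimE := by simp [Q₀]
  have hV : ∑ k, (Q₀ k).dimV = ∑ i, (Q i).dimV := by simp [Q₀]
  rw [finrank_directSum_E, hE] at h1
  rw [finrank_directSum_V, hV] at h2
  -- `a` is the excess of `dim ker g` over the tight value, filled by copies of `⁰T_1` with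
  -- dimensions `(1, 1)`; `b` is the excess of `dim ker f` over `dim ker g`, filled by copies of
  -- `⁰T_0⁰` with dimensions `(1, 0)`.
  obtain ⟨a, ha⟩ := Nat.exists_eq_add_of_le (h4.trans h8)
  obtain ⟨b, hb⟩ := Nat.exists_eq_add_of_le h7
  refine ⟨a, b, d'.nonempty_iso (LeftContraction.directSum c ?_ ?_) ?_ ?_⟩
  · rintro (j | j) x
    · funext i
      rw [Subsingleton.elim i 0]
      exact nilp_zero 0 x
    · exact funext fun i => i.elim0
  · rintro (j | j) x
    · exact ⟨x, rfl⟩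
    · exact ⟨0, funext fun i => i.elim0⟩
  · have e1 : (zeroT K 1).dimE = 1 := Module.finrank_fin_fun K
    have e2 : (zeroTZero K 0).dimE = 1 := Module.finrank_fin_fun K
    rw [finrank_directSum_E]
    simp only [Fintype.sum_sum_type, Sum.elim_inl, Sum.elim_inr, e1, e2, Finset.sum_const,
      Finset.card_univ, Fintype.card_fin, smul_eq_mul, mul_one]
    omega
  · have e1 : (zeroT K 1).dimV = 1 := Module.finrank_fin_fun K
    have e2 : (zeroTZero K 0).dimV = 0 := Module.finrank_fin_fun K
    rw [finrank_directSum_V]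
    simp only [Fintype.sum_sum_type, Sum.elim_inl, Sum.elim_inr, e1, e2, Finset.sum_const,
      Finset.card_univ, Fintype.card_fin, smul_eq_mul, mul_one, mul_zero]
    omega

/-- A projection `π → ρ` whose kernel consists of summands `⁰T_0⁰`. -/
structure NullExtension (π : TsfPair.{u, v} K) (ρ : TsfPair.{u, w} K) where
  f : π.E →ₗ[K] ρ.E
  g : π.V ≃ₗ[K] ρ.V
  comm_μ : ∀ x, ρ.μ (f x) = g (π.μ x)
  comm_ν : ∀ x, ρ.ν (f x) = g (π.ν x)
  surj_f : Function.Surjective f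

namespace NullExtension

variable {π : TsfPair.{u, v} K} {π' : TsfPair.{u, v₁} K} {ρ : TsfPair.{u, w} K}

/-- A null extension may be followed by an isomorphism. -/
def transIso (c : NullExtension π ρ) (e : Iso ρ π') : NullExtension π π' where
  f := e.α.toLinearMap ∘ₗ c.f
  g := c.g ≪≫ₗ e.β
  comm_μ x := by simp [e.comm_μ, c.comm_μ]
  comm_ν x := by simp [e.comm_ν, c.comm_ν]
  surj_f := e.α.surjective.comp c.surj_f

/-- Both maps of `π` factor through `f`, as `g` is an isomorphism; any isomorphism of the domains
over `ρ.E` is therefore compatible with them. -/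
theorem nonempty_iso (c : NullExtension π ρ) (c' : NullExtension π' ρ)
    (hE : Module.finrank K π.E = Module.finrank K π'.E) : Nonempty (Iso π π') := by
  obtain ⟨α, hα⟩ := LinearMap.exists_equiv_lift_of_surjective c.f c'.f c.surj_f c'.surj_f
    (LinearEquiv.refl K ρ.E) hE
  refine ⟨⟨α, c.g ≪≫ₗ c'.g.symm, fun x => ?_, fun x => ?_⟩⟩
  · rw [LinearEquiv.trans_apply, LinearEquiv.eq_symm_apply, ← c'.comm_μ, hα, ← c.comm_μ]
    rfl
  · rw [LinearEquiv.trans_apply, LinearEquiv.eq_symm_apply, ← c'.comm_ν, hα, ← c.comm_ν]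
    rfl

theorem exists_iso (c : NullExtension π ρ) {ι : Type w₁} [Finite ι] {P : ι → TsfPair.{u, u} K}
    (e : Iso ρ (TsfPair.directSum P)) :
    ∃ a : ℕ, Nonempty (Iso π (TsfPair.directSum
      (Sum.elim P (fun _ : Fin a => zeroTZero K 0)))) := by
  have := Fintype.ofFinite ι
  let c' := c.transIso e
  have h1 : Module.finrank K (TsfPair.directSum P).E ≤ Module.finrank K π.E :=
    LinearMap.finrank_le_finrank_of_surjective c'.surj_f
  let P' : ∀ a : ℕ, ι ⊕ Fin a → TsfPair.{u, u} K :=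
    fun a => Sum.elim P (fun _ : Fin a => zeroTZero K 0)
  let g : ∀ a, (∀ k, (P' a k).V) →ₗ[K] ∀ i, (P i).V :=
    fun a => LinearMap.pi fun i => LinearMap.proj (Sum.inl i)
  have hg : ∀ a, Function.Bijective (g a) := fun a =>
    bijective_restrict Sum.inl Sum.inl_injective (fun k => (P' a k).V) fun k hk => by
      rcases k with i | j
      · exact absurd ⟨i, rfl⟩ hk
      · exact ⟨⟨⟨0⟩, fun _ => funext fun i => i.elim0⟩⟩
  -- Each `⁰T_0⁰` adds one dimension to the domain and none to the codomain, so their number is the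
  -- dimension of the kernel of the projection.
  refine ⟨Module.finrank K π.E - Module.finrank K (TsfPair.directSum P).E, c'.nonempty_iso
    ⟨(LinearMap.pi fun i => LinearMap.proj (Sum.inl i) :
      (∀ k, (P' _ k).E) →ₗ[K] ∀ i, (P i).E), LinearEquiv.ofBijective (g _) (hg _),
      fun x => rfl, fun x => rfl, ?_⟩ ?_⟩
  · intro y
    exact ⟨fun k => match k with
      | Sum.inl i => y i
      | Sum.inr j => (0 : (zeroTZero K 0).E), rfl⟩
  · have e2 : (zeroTZero K 0).dimE = 1 := Module.finrank_fin_fun K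
    rw [finrank_directSum_E] at h1 ⊢
    rw [finrank_directSum_E]
    simp only [Fintype.sum_sum_type, Sum.elim_inl, Sum.elim_inr, e2, Finset.sum_const,
      Finset.card_univ, Fintype.card_fin, smul_eq_mul, mul_one]
    omega

end NullExtension

end TsfPair

/-! ### Null types and sums with null types -/

/-- The types `⁰T_{n+1}`, `T_{n+1}⁰` and `⁰T_n⁰`, which the `C`-stabilization kills. -/
inductive NullType : Type
  | zeroT (n : ℕ)
  | tZero (n : ℕ)
  | zeroTZero (n : ℕ)

namespace NullType

open TsfPair

variable (K : Type u) [Field K]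

/-- The transformation-pair of a null type. -/
noncomputable def toPair : NullType → TsfPair.{u, u} K
  | zeroT n => TsfPair.zeroT K (n + 1)
  | tZero n => TsfPair.tZero K (n + 1)
  | zeroTZero n => TsfPair.zeroTZero K n

/-- The null type obtained by exchanging the two maps. -/
def swap : NullType → NullType
  | zeroT n => tZero n
  | tZero n => zeroT n
  | zeroTZero n => zeroTZero n

/-- The null type whose left contraction is the given one. -/
def lift : NullType → NullType
  | zeroT n => zeroT (n + 1)
  | tZero n => tZero n
  | zeroTZero n => zeroTZero (n + 1)

theorem nonempty_iso_swap (c : NullType) :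
    Nonempty (TsfPair.Iso (c.toPair K).swap (c.swap.toPair K)) :=
  match c with
  | zeroT _ => ⟨Iso.refl _⟩
  | tZero _ => ⟨Iso.refl _⟩
  | zeroTZero n => ⟨zeroTZeroSwap n⟩

theorem tZero_μ_injective (n : ℕ) : Function.Injective (TsfPair.tZero K n).μ := fun _ _ h => h

/-- The left contraction of the lift of a null type. -/
noncomputable def contraction : ∀ c : NullType, LeftContraction (c.lift.toPair K) (c.toPair K)
  | zeroT n => zeroTContraction n
  | tZero n => LeftContraction.ofInjective (tZero_μ_injective K (n + 1))
  | zeroTZero n => zeroTZeroContraction n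

theorem tight (c : NullType) : LeftContraction.Tight (c.lift.toPair K) :=
  match c with
  | zeroT n => zeroT_tight n
  | tZero n => LeftContraction.Tight.of_injective (tZero_μ_injective K (n + 1))
  | zeroTZero n => zeroTZero_tight n

end NullType

namespace TsfPair

variable {K : Type u} [Field K]

/-- `π` is the direct sum of the family `A` and of null types. -/
def IsSumWithNull {I : Type} [Finite I] (A : I → TsfPair.{u, u} K) (π : TsfPair.{u, v} K) : Prop :=
  ∃ (J : Type) (_ : Finite J) (c : J → NullType),
    Nonempty (Iso π (directSum (Sum.elim A fun j => (c j).toPair K)))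

namespace IsSumWithNull

variable {I : Type} [Finite I] {A : I → TsfPair.{u, u} K} {π : TsfPair.{u, v} K}
  {ρ : TsfPair.{u, w} K}

theorem swap (h : IsSumWithNull A π) : IsSumWithNull (fun i => (A i).swap) π.swap := by
  obtain ⟨J, hJ, c, ⟨f⟩⟩ := h
  have h1 : ∀ k : I ⊕ J, Nonempty (Iso (Sum.elim A (fun j => (c j).toPair K) k).swap
      (Sum.elim (fun i => (A i).swap) (fun j => (c j).swap.toPair K) k)) := by
    rintro (i | j)
    · exact ⟨Iso.refl _⟩
    · exact NullType.nonempty_iso_swap K (c j)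
  exact ⟨J, hJ, fun j => (c j).swap, ⟨f.swap.trans
    (Iso.directSum (P := fun k => (Sum.elim A (fun j => (c j).toPair K) k).swap)
      fun k => (h1 k).some)⟩⟩

theorem of_nullExtension (h : IsSumWithNull A ρ) (d : NullExtension π ρ) : IsSumWithNull A π := by
  obtain ⟨J, hJ, c, ⟨f⟩⟩ := h
  obtain ⟨a, ⟨e⟩⟩ := d.exists_iso f
  refine ⟨J ⊕ Fin a, inferInstance, Sum.elim c fun _ => NullType.zeroTZero 0, ?_⟩
  obtain ⟨e'⟩ := nonempty_iso_directSum_reindex (K := K) (Equiv.sumAssoc I J (Fin a))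
    (P := Sum.elim (Sum.elim A fun j => (c j).toPair K) (fun _ : Fin a => zeroTZero K 0))
    (Q := Sum.elim A fun j =>
      ((Sum.elim c fun _ => NullType.zeroTZero 0 : J ⊕ Fin a → NullType) j).toPair K) (by
      rintro ((i | j) | k)
      · exact ⟨Iso.refl _⟩
      · exact ⟨Iso.refl _⟩
      · exact ⟨Iso.refl _⟩)
  exact ⟨e.trans e'⟩

/-- A summand with injective `μ` is its own tight left contraction, a null type has a null lift, and
the filling summands `⁰T_1` and `⁰T_0⁰` are null. Hence the family `A` is unaffected. -/
theorem of_leftContraction (hA : ∀ i, Function.Injective (A i).μ) (h : IsSumWithNull A ρ)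
    (d : LeftContraction π ρ) : IsSumWithNull A π := by
  obtain ⟨J, hJ, c, ⟨f⟩⟩ := h
  obtain ⟨a, b, ⟨e⟩⟩ := d.exists_lift (P := Sum.elim A fun j => (c j).toPair K)
    (Q := Sum.elim A fun j => (c j).lift.toPair K)
    (fun k => match k with
      | Sum.inl i => LeftContraction.ofInjective (hA i)
      | Sum.inr j => (c j).contraction K)
    (fun k => match k with
      | Sum.inl i => LeftContraction.Tight.of_injective (hA i)
      | Sum.inr j => (c j).tight K) f
  refine ⟨J ⊕ (Fin a ⊕ Fin b), inferInstance, Sum.elim (fun j => (c j).lift) (Sum.elim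
    (fun _ => NullType.zeroT 0) (fun _ => NullType.zeroTZero 0)), ?_⟩
  obtain ⟨e'⟩ := nonempty_iso_directSum_reindex (K := K) (Equiv.sumAssoc I J (Fin a ⊕ Fin b))
    (P := Sum.elim (Sum.elim A fun j => (c j).lift.toPair K)
      (Sum.elim (fun _ : Fin a => zeroT K 1) (fun _ : Fin b => zeroTZero K 0)))
    (Q := Sum.elim A fun j => ((Sum.elim (fun j => (c j).lift) (Sum.elim
      (fun _ => NullType.zeroT 0) (fun _ => NullType.zeroTZero 0)) :
        J ⊕ (Fin a ⊕ Fin b) → NullType) j).toPair K) (by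
      rintro ((i | j) | (k | k))
      · exact ⟨Iso.refl _⟩
      · exact ⟨Iso.refl _⟩
      · exact ⟨Iso.refl _⟩
      · exact ⟨Iso.refl _⟩)
  exact ⟨e.trans e'⟩

/-- Lifting along a map that is the projection onto the left contraction up to summands `⁰T_0⁰`. -/
theorem of_weak_leftContraction (hA : ∀ i, Function.Injective (A i).μ) (h : IsSumWithNull A ρ)
    (f : π.E →ₗ[K] ρ.E) (g : π.V →ₗ[K] ρ.V)
    (comm_μ : ∀ x, ρ.μ (f x) = g (π.μ x)) (comm_ν : ∀ x, ρ.ν (f x) = g (π.ν x))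
    (surj_f : Function.Surjective f) (surj_g : Function.Surjective g)
    (ker_f : LinearMap.ker π.μ ≤ LinearMap.ker f)
    (ker_g : LinearMap.ker g ≤ (LinearMap.ker π.μ).map π.ν) : IsSumWithNull A π := by
  have ker_g' : (LinearMap.ker π.μ).map π.ν ≤ LinearMap.ker g := by
    rintro _ ⟨x, hx, rfl⟩
    rw [LinearMap.mem_ker, ← comm_ν, LinearMap.mem_ker.1 (ker_f hx), map_zero]
  -- The map `(f, g)` factors through the true left contraction. The factor is an isomorphism on
  -- codomains because the kernels agree, but only a surjection on domains: a null extension.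
  refine of_leftContraction hA (of_nullExtension h ?_) (LeftContraction.toQuot π)
  refine ⟨Submodule.liftQ (LinearMap.ker π.μ) f ker_f, LinearEquiv.ofBijective
    (Submodule.liftQ ((LinearMap.ker π.μ).map π.ν) g ker_g') ⟨?_, ?_⟩, ?_, ?_, ?_⟩
  · rw [← LinearMap.ker_eq_bot, Submodule.ker_liftQ, eq_bot_iff,
      Submodule.map_le_iff_le_comap]
    exact ker_g.trans (Submodule.ker_mkQ _).ge
  · intro y
    obtain ⟨x, rfl⟩ := surj_g y
    exact ⟨Submodule.Quotient.mk x, rfl⟩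
  · intro x
    obtain ⟨x, rfl⟩ := Submodule.mkQ_surjective _ x
    exact comm_μ x
  · intro x
    obtain ⟨x, rfl⟩ := Submodule.mkQ_surjective _ x
    exact comm_ν x
  · intro y
    obtain ⟨x, rfl⟩ := surj_f y
    exact ⟨Submodule.Quotient.mk x, rfl⟩

end IsSumWithNull

end TsfPair

/-! ### Kernels of linearized maps between sets -/

section Finsupp

variable (K : Type u) [Field K]

/-- The kernel is spanned by differences of basis vectors in a common fibre: moving every point to a
chosen point of its fibre changes `x` by such differences, and the moved vector depends only on the
image of `x`. -/
theorem ker_lmapDomain_le {S : Type v} {S' : Type w} (q : S → S') (W : Submodule K (S →₀ K))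
    (h : ∀ a b, q a = q b → Finsupp.single a 1 - Finsupp.single b 1 ∈ W) :
    LinearMap.ker (Finsupp.lmapDomain K K q) ≤ W := by
  rcases isEmpty_or_nonempty S with hS | hS
  · intro x _
    rw [Subsingleton.elim x 0]
    exact W.zero_mem
  · have key : ∀ x : S →₀ K, x - Finsupp.lmapDomain K K (Function.invFun q)
        (Finsupp.lmapDomain K K q x) ∈ W := by
      intro x
      induction x using Finsupp.induction_linear with
      | zero => simp
      | add x y hx hy =>
        rw [map_add, map_add, add_sub_add_comm]
        exact W.add_mem hx hy
      | single a c =>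
        have h1 := W.smul_mem c (h a (Function.invFun q (q a))
          (Function.invFun_eq ⟨a, rfl⟩).symm)
        simpa [smul_sub] using h1
    intro x hx
    have h1 := key x
    rwa [LinearMap.mem_ker.1 hx, map_zero, sub_zero] at h1

theorem ker_lmapDomain_le_ker {R : Type v} {S : Type w} {R' : Type w₁} (s : R → S) (φ : R → R')
    (h : ∀ e e', s e = s e' → φ e = φ e') :
    LinearMap.ker (Finsupp.lmapDomain K K s) ≤ LinearMap.ker (Finsupp.lmapDomain K K φ) :=
  ker_lmapDomain_le K s _ fun a b hab => by
    rw [LinearMap.mem_ker, map_sub, Finsupp.lmapDomain_apply, Finsupp.lmapDomain_apply,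
      Finsupp.mapDomain_single, Finsupp.mapDomain_single, h a b hab, sub_self]

theorem lmapDomain_square {R : Type v} {S : Type w} {R' : Type w₁} {S' : Type w₂} (a : R → S)
    (b : S → S') (c : R → R') (d : R' → S') (h : ∀ e, d (c e) = b (a e)) (x : R →₀ K) :
    Finsupp.lmapDomain K K d (Finsupp.lmapDomain K K c x) =
      Finsupp.lmapDomain K K b (Finsupp.lmapDomain K K a x) := by
  rw [← LinearMap.comp_apply, ← LinearMap.comp_apply, ← Finsupp.lmapDomain_comp,
    ← Finsupp.lmapDomain_comp, show d ∘ c = b ∘ a from funext h]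

theorem domLCongr_eq_lmapDomain {R : Type v} {S : Type w} (e : R ≃ S) (x : R →₀ K) :
    (Finsupp.domLCongr e : (R →₀ K) ≃ₗ[K] (S →₀ K)) x = Finsupp.lmapDomain K K e x := by
  rw [Finsupp.domLCongr_apply, Finsupp.domCongr_apply, Finsupp.equivMapDomain_eq_mapDomain,
    Finsupp.lmapDomain_apply]

/-- A difference of basis vectors telescopes along a chain of generating pairs. Each link is the
image under `t` of a difference of two elements with equal `s`, which lies in the kernel. -/
theorem ker_lmapDomain_le_map {R : Type v} {S : Type w} {S' : Type w₁} (s t : R → S) (q : S → S')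
    (h : ∀ a b, q a = q b →
      Relation.EqvGen (fun y y' => ∃ e e', s e = s e' ∧ t e = y ∧ t e' = y') a b) :
    LinearMap.ker (Finsupp.lmapDomain K K q) ≤
      (LinearMap.ker (Finsupp.lmapDomain K K s)).map (Finsupp.lmapDomain K K t) := by
  refine ker_lmapDomain_le K q _ fun a b hab => ?_
  have key := h a b hab
  clear h hab
  induction key with
  | rel a b hr =>
    obtain ⟨e, e', he, rfl, rfl⟩ := hr
    refine ⟨Finsupp.single e 1 - Finsupp.single e' 1, ?_, ?_⟩
    · rw [SetLike.mem_coe, LinearMap.mem_ker, map_sub, Finsupp.lmapDomain_apply,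
        Finsupp.lmapDomain_apply, Finsupp.mapDomain_single, Finsupp.mapDomain_single, he, sub_self]
    · rw [map_sub, Finsupp.lmapDomain_apply, Finsupp.lmapDomain_apply, Finsupp.mapDomain_single,
        Finsupp.mapDomain_single]
  | refl a => rw [sub_self]; exact Submodule.zero_mem _
  | symm a b _ ih =>
    rw [← neg_sub]
    exact Submodule.neg_mem _ ih
  | trans a b c _ _ ih1 ih2 =>
    rw [← sub_add_sub_cancel _ (Finsupp.single b 1)]
    exact Submodule.add_mem _ ih1 ih2

end Finsupp

/-! ### Contractions of a relation and its linearization -/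

namespace BinRel

open TsfPair

variable (K : Type u) [Field K]

instance (Γ : BinRel.{v}) [Finite Γ.carrier] : Finite Γ.leftContraction.carrier :=
  inferInstanceAs (Finite (Quotient _))

instance (Γ : BinRel.{v}) [Finite Γ.carrier] : Finite Γ.rightContraction.carrier :=
  inferInstanceAs (Finite (Quotient _))

/-- The edges of a binary relation. -/
abbrev Edge (Γ : BinRel.{v}) : Type v := {e : Γ.carrier × Γ.carrier // Γ.rel e.1 e.2}

/-- Isomorphic relations have isomorphic linearizations. -/
noncomputable def linearizationCongr {Γ : BinRel.{v}} {Δ : BinRel.{w}} [Finite Γ.carrier]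
    [Finite Δ.carrier] (e : Iso Γ Δ) : TsfPair.Iso (Γ.linearization K) (Δ.linearization K) where
  α := Finsupp.domLCongr ((e.toEquiv.prodCongr e.toEquiv).subtypeEquiv
    (fun _ => e.map_rel_iff.symm) : Γ.Edge ≃ Δ.Edge)
  β := Finsupp.domLCongr e.toEquiv
  comm_μ x := (congrArg _ (domLCongr_eq_lmapDomain K _ x)).trans
    ((lmapDomain_square K _ _ _ _ (by intro; rfl) x).trans (domLCongr_eq_lmapDomain K _ _).symm)
  comm_ν x := (congrArg _ (domLCongr_eq_lmapDomain K _ x)).trans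
    ((lmapDomain_square K _ _ _ _ (by intro; rfl) x).trans (domLCongr_eq_lmapDomain K _ _).symm)

/-- The map on edges induced by the projection onto a quotient. -/
def quotientEdge (Γ : BinRel.{v}) (s : Setoid Γ.carrier) (e : Γ.Edge) : (Γ.quotient s).Edge :=
  ⟨(Quotient.mk s e.1.1, Quotient.mk s e.1.2), e.1.1, e.1.2, rfl, rfl, e.2⟩

theorem quotientEdge_surjective (Γ : BinRel.{v}) (s : Setoid Γ.carrier) :
    Function.Surjective (Γ.quotientEdge s) := by
  rintro ⟨⟨_, _⟩, a, b, ha, hb, h⟩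
  exact ⟨⟨(a, b), h⟩, Subtype.ext (Prod.ext ha hb)⟩

variable {K}
variable {I : Type} [Finite I] {A : I → TsfPair.{u, u} K}

/-- Two edges with the same source get the same image, since their targets are identified; this
handles `ker μ`. The equivalence is generated by pairs of targets of such edges, so what dies in the
vertex space lies in `ν(ker μ)`. -/
theorem isSumWithNull_of_leftContraction (hA : ∀ i, Function.Injective (A i).μ) (Γ : BinRel.{v})
    [Finite Γ.carrier] (h : IsSumWithNull A (Γ.leftContraction.linearization K)) :
    IsSumWithNull A (Γ.linearization K) := by
  refine h.of_weak_leftContraction hA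
    (Finsupp.lmapDomain K K (Γ.quotientEdge Γ.leftSetoid))
    (Finsupp.lmapDomain K K (Quotient.mk Γ.leftSetoid)) (fun x => ?_) (fun x => ?_)
    (Finsupp.mapDomain_surjective (Γ.quotientEdge_surjective _))
    (Finsupp.mapDomain_surjective Quotient.mk_surjective)
    (ker_lmapDomain_le_ker K (fun e : Γ.Edge => e.1.1) (Γ.quotientEdge Γ.leftSetoid) ?_)
    (ker_lmapDomain_le_map K (fun e : Γ.Edge => e.1.1) (fun e : Γ.Edge => e.1.2) _ ?_)
  · exact lmapDomain_square K _ _ _ _ (by intro; rfl) x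
  · exact lmapDomain_square K _ _ _ _ (by intro; rfl) x
  · rintro ⟨⟨a, b⟩, h1⟩ ⟨⟨a', b'⟩, h2⟩ (rfl : a = a')
    refine Subtype.ext (Prod.ext rfl ?_)
    exact Quotient.sound (s := Γ.leftSetoid) (Relation.EqvGen.rel _ _ ⟨a, h1, h2⟩)
  · intro a b hab
    refine Relation.EqvGen.mono (fun y y' => ?_) a b (Quotient.exact hab)
    rintro ⟨x, h1, h2⟩
    exact ⟨⟨(x, y), h1⟩, ⟨(x, y'), h2⟩, rfl, rfl, rfl⟩

/-- The left-hand argument for the pair with `μ` and `ν` exchanged; accordingly injectivity of `ν`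
is now what protects `A`. -/
theorem isSumWithNull_of_rightContraction (hA : ∀ i, Function.Injective (A i).ν) (Γ : BinRel.{v})
    [Finite Γ.carrier] (h : IsSumWithNull A (Γ.rightContraction.linearization K)) :
    IsSumWithNull A (Γ.linearization K) := by
  refine IsSumWithNull.swap (π := (Γ.linearization K).swap) (h.swap.of_weak_leftContraction hA
    (Finsupp.lmapDomain K K (Γ.quotientEdge Γ.rightSetoid))
    (Finsupp.lmapDomain K K (Quotient.mk Γ.rightSetoid)) (fun x => ?_) (fun x => ?_)
    (Finsupp.mapDomain_surjective (Γ.quotientEdge_surjective _))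
    (Finsupp.mapDomain_surjective Quotient.mk_surjective)
    (ker_lmapDomain_le_ker K (fun e : Γ.Edge => e.1.2) (Γ.quotientEdge Γ.rightSetoid) ?_)
    (ker_lmapDomain_le_map K (fun e : Γ.Edge => e.1.2) (fun e : Γ.Edge => e.1.1) _ ?_))
  · exact lmapDomain_square K _ _ _ _ (by intro; rfl) x
  · exact lmapDomain_square K _ _ _ _ (by intro; rfl) x
  · rintro ⟨⟨b, a⟩, h1⟩ ⟨⟨b', a'⟩, h2⟩ (rfl : a = a')
    refine Subtype.ext (Prod.ext ?_ rfl)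
    exact Quotient.sound (s := Γ.rightSetoid) (Relation.EqvGen.rel _ _ ⟨a, h1, h2⟩)
  · intro a b hab
    refine Relation.EqvGen.mono (fun y y' => ?_) a b (Quotient.exact hab)
    rintro ⟨x, h1, h2⟩
    exact ⟨⟨(y, x), h1⟩, ⟨(y', x), h2⟩, rfl, rfl, rfl⟩

theorem finite_iterate {f : BinRel.{v} → BinRel.{v}}
    (hf : ∀ Γ : BinRel.{v}, Finite Γ.carrier → Finite (f Γ).carrier) (k : ℕ) (Γ : BinRel.{v})
    (hΓ : Finite Γ.carrier) : Finite (f^[k] Γ).carrier := by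
  induction k generalizing Γ with
  | zero => exact hΓ
  | succ k ih => exact ih _ (hf Γ hΓ)

theorem isSumWithNull_of_iterate {f : BinRel.{v} → BinRel.{v}}
    (hf : ∀ Γ : BinRel.{v}, Finite Γ.carrier → Finite (f Γ).carrier)
    (h : ∀ (Γ : BinRel.{v}) (_ : Finite Γ.carrier) (_ : Finite (f Γ).carrier),
      IsSumWithNull A ((f Γ).linearization K) → IsSumWithNull A (Γ.linearization K))
    (k : ℕ) (Γ : BinRel.{v}) [hΓ : Finite Γ.carrier] [Finite (f^[k] Γ).carrier]
    (hk : IsSumWithNull A ((f^[k] Γ).linearization K)) :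
    IsSumWithNull A (Γ.linearization K) := by
  induction k generalizing Γ with
  | zero => exact hk
  | succ k ih =>
    have h1 := hf Γ hΓ
    have h2 : Finite (f^[k] (f Γ)).carrier := finite_iterate hf k _ h1
    exact h Γ hΓ h1 (ih (f Γ) hk)

theorem isSumWithNull_of_cStabilization (hμ : ∀ i, Function.Injective (A i).μ)
    (hν : ∀ i, Function.Injective (A i).ν) (Γ : BinRel.{v}) [hΓ : Finite Γ.carrier]
    [hC : Finite Γ.cStabilization.carrier]
    (h : IsSumWithNull A (Γ.cStabilization.linearization K)) :
    IsSumWithNull A (Γ.linearization K) := by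
  have hr : ∀ Γ : BinRel.{v}, Finite Γ.carrier → Finite Γ.rightContraction.carrier :=
    fun _ _ => inferInstance
  have hl : ∀ Γ : BinRel.{v}, Finite Γ.carrier → Finite Γ.leftContraction.carrier :=
    fun _ _ => inferInstance
  have h1 := finite_iterate hr (Nat.card Γ.carrier) Γ hΓ
  refine isSumWithNull_of_iterate hr (fun Γ _ _ => isSumWithNull_of_rightContraction hν Γ)
    (Nat.card Γ.carrier) Γ ?_
  have : Finite (leftContraction^[Nat.card Γ.carrier]
    (rightContraction^[Nat.card Γ.carrier] Γ)).carrier := hC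
  exact isSumWithNull_of_iterate hl (fun Γ _ _ => isSumWithNull_of_leftContraction hμ Γ)
    (Nat.card Γ.carrier) _ h

end BinRel

/-! ### Linearizations of disjoint unions, paths and cycles -/

namespace TsfPair

variable {K : Type u} [Field K] {ι : Type w} [Finite ι] {κ : ι → Type w₁} {σ : ι → Type w₂}
  {P : ι → TsfPair.{u, v} K}

/-- The basis of the domain of a direct sum given by bases of the summands. -/
noncomputable def directSumBasisE (b : ∀ i, Module.Basis (κ i) K (P i).E) :
    Module.Basis (Σ i, κ i) K (directSum P).E :=
  haveI := Fintype.ofFinite ι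
  Pi.basis b

/-- The basis of the codomain of a direct sum given by bases of the summands. -/
noncomputable def directSumBasisV (b : ∀ i, Module.Basis (κ i) K (P i).V) :
    Module.Basis (Σ i, κ i) K (directSum P).V :=
  haveI := Fintype.ofFinite ι
  Pi.basis b

theorem directSum_μ_basis (b : ∀ i, Module.Basis (κ i) K (P i).E)
    (b' : ∀ i, Module.Basis (σ i) K (P i).V) (i : ι) (k : κ i) (k' : σ i)
    (h : (P i).μ (b i k) = b' i k') :
    (directSum P).μ (directSumBasisE b ⟨i, k⟩) = directSumBasisV b' ⟨i, k'⟩ := by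
  classical
  have := Fintype.ofFinite ι
  have h1 : directSumBasisE b ⟨i, k⟩ = (Pi.single i (b i k) : ∀ i, (P i).E) := Pi.basis_apply b _
  have h2 : directSumBasisV b' ⟨i, k'⟩ = (Pi.single i (b' i k') : ∀ i, (P i).V) :=
    Pi.basis_apply b' _
  rw [h1, h2]
  funext j
  change (P j).μ (Pi.single (M := fun i => (P i).E) i (b i k) j) =
    Pi.single (M := fun i => (P i).V) i (b' i k') j
  rcases eq_or_ne j i with rfl | hj
  · rw [Pi.single_eq_same, Pi.single_eq_same, h]
  · rw [Pi.single_eq_of_ne hj, Pi.single_eq_of_ne hj, map_zero]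

theorem directSum_ν_basis (b : ∀ i, Module.Basis (κ i) K (P i).E)
    (b' : ∀ i, Module.Basis (σ i) K (P i).V) (i : ι) (k : κ i) (k' : σ i)
    (h : (P i).ν (b i k) = b' i k') :
    (directSum P).ν (directSumBasisE b ⟨i, k⟩) = directSumBasisV b' ⟨i, k'⟩ :=
  directSum_μ_basis (P := fun i => (P i).swap) b b' i k k' h

end TsfPair

namespace BinRel

open TsfPair

variable (K : Type u) [Field K]

/-- The basis of `KR` given by an enumeration of the edges. -/
noncomputable def edgeBasis {Γ : BinRel.{v}} [Finite Γ.carrier] {ι : Type w} (e : ι ≃ Γ.Edge) :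
    Module.Basis ι K (Γ.linearization K).E :=
  (Finsupp.basisSingleOne (R := K) (ι := Γ.Edge)).reindex e.symm

/-- The basis of `KS` given by the vertices. -/
noncomputable def vertexBasis (Γ : BinRel.{v}) [Finite Γ.carrier] :
    Module.Basis Γ.carrier K (Γ.linearization K).V :=
  Finsupp.basisSingleOne (R := K) (ι := Γ.carrier)

theorem edgeBasis_apply {Γ : BinRel.{v}} [Finite Γ.carrier] {ι : Type w} (e : ι ≃ Γ.Edge) (i : ι) :
    edgeBasis K e i = (Finsupp.single (e i) 1 : Γ.Edge →₀ K) := by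
  refine (Module.Basis.reindex_apply (Finsupp.basisSingleOne (R := K) (ι := Γ.Edge)) e.symm
    i).trans ?_
  rw [Finsupp.coe_basisSingleOne, Equiv.symm_symm]

theorem vertexBasis_apply (Γ : BinRel.{v}) [Finite Γ.carrier] (x : Γ.carrier) :
    vertexBasis K Γ x = (Finsupp.single x 1 : Γ.carrier →₀ K) :=
  congrFun Finsupp.coe_basisSingleOne x

theorem linearization_μ_edgeBasis {Γ : BinRel.{v}} [Finite Γ.carrier] {ι : Type w}
    (e : ι ≃ Γ.Edge) (i : ι) :
    (Γ.linearization K).μ (edgeBasis K e i) = vertexBasis K Γ (e i).1.1 := by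
  rw [edgeBasis_apply, vertexBasis_apply]
  exact Finsupp.mapDomain_single

theorem linearization_ν_edgeBasis {Γ : BinRel.{v}} [Finite Γ.carrier] {ι : Type w}
    (e : ι ≃ Γ.Edge) (i : ι) :
    (Γ.linearization K).ν (edgeBasis K e i) = vertexBasis K Γ (e i).1.2 := by
  rw [edgeBasis_apply, vertexBasis_apply]
  exact Finsupp.mapDomain_single

/-- The edges of a disjoint union. -/
noncomputable def disjointUnionEdge {ι : Type w} (G : ι → BinRel.{v}) :
    (Σ i, (G i).Edge) ≃ (disjointUnion G).Edge :=
  Equiv.ofBijective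
    (fun x => ⟨(⟨x.1, x.2.1.1⟩, ⟨x.1, x.2.1.2⟩), DisjointUnionRel.mk x.1 _ _ x.2.2⟩) <| by
    constructor
    · rintro ⟨i, ⟨⟨a, b⟩, h⟩⟩ ⟨j, ⟨⟨a', b'⟩, h'⟩⟩ hij
      obtain ⟨h1, h2⟩ := Prod.ext_iff.1 (Subtype.ext_iff.1 hij)
      obtain ⟨h3, h4⟩ := Sigma.mk.inj h1
      obtain rfl : i = j := h3
      obtain rfl : a = a' := eq_of_heq h4
      obtain rfl : b = b' := eq_of_heq (Sigma.mk.inj h2).2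
      rfl
    · rintro ⟨⟨x, y⟩, h⟩
      change DisjointUnionRel G x y at h
      obtain ⟨i, a, b, h⟩ := h
      exact ⟨⟨i, ⟨(a, b), h⟩⟩, rfl⟩

/-- The linearization of a disjoint union is the direct sum of the linearizations. -/
noncomputable def linearizationDisjointUnion {ι : Type w} [Finite ι] (G : ι → BinRel.{v})
    [∀ i, Finite (G i).carrier] [Finite (disjointUnion G).carrier] :
    TsfPair.Iso ((disjointUnion G).linearization K)
      (directSum fun i => (G i).linearization K) :=
  let b := fun i => edgeBasis K (Equiv.refl (G i).Edge)
  let b' := fun i => vertexBasis K (G i)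
  Iso.ofBases (K := K) (ι := Σ i, (G i).Edge) (κ := Σ i, (G i).carrier)
    (fun x => ⟨x.1, x.2.1.1⟩) (fun x => ⟨x.1, x.2.1.2⟩)
    (edgeBasis K (disjointUnionEdge G)) (directSumBasisE b)
    (vertexBasis K (disjointUnion G)) (directSumBasisV b')
    (fun x => linearization_μ_edgeBasis K (disjointUnionEdge G) x)
    (fun x => directSum_μ_basis b b' x.1 x.2 x.2.1.1 (linearization_μ_edgeBasis K _ x.2))
    (fun x => linearization_ν_edgeBasis K (disjointUnionEdge G) x)
    (fun x => directSum_ν_basis b b' x.1 x.2 x.2.1.2 (linearization_ν_edgeBasis K _ x.2))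

instance (N : ℕ) : Finite (path N).carrier := inferInstanceAs (Finite (Fin N))

instance (N : ℕ) : Finite (cycle N).carrier := inferInstanceAs (Finite (Fin N))

/-- The edges of the path with `t + 1` vertices. -/
noncomputable def pathEdge (t : ℕ) : Fin t ≃ (path (t + 1)).Edge :=
  Equiv.ofBijective (fun j => ⟨(j.castSucc, j.succ), rfl⟩) <| by
    constructor
    · intro i j h
      exact Fin.castSucc_injective t (Prod.ext_iff.1 (Subtype.ext_iff.1 h)).1
    · rintro ⟨⟨a, b⟩, h⟩
      replace h : (Fin.val a : ℕ) + 1 = Fin.val b := h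
      have hb : Fin.val b < t + 1 := b.isLt
      exact ⟨⟨Fin.val a, by omega⟩, Subtype.ext (Prod.ext rfl (Fin.ext h))⟩

/-- The linearization of the path with `t + 1` vertices is `T_t`. -/
noncomputable def linearizationPath (t : ℕ) :
    TsfPair.Iso ((path (t + 1)).linearization K) (tType K t) :=
  Iso.ofBases (K := K) (ι := Fin t) (κ := Fin (t + 1)) Fin.castSucc Fin.succ
    (edgeBasis K (pathEdge t)) (Pi.basisFun K (Fin t))
    (vertexBasis K (path (t + 1))) (Pi.basisFun K (Fin (t + 1)))
    (linearization_μ_edgeBasis K (pathEdge t))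
    (fun j => ((Pi.basisFun K (Fin t)).constr_basis K
      (fun i => (Pi.single i.castSucc 1 : Fin (t + 1) → K)) j).trans
      (Pi.basisFun_apply K (Fin (t + 1)) j.castSucc).symm)
    (linearization_ν_edgeBasis K (pathEdge t))
    (fun j => ((Pi.basisFun K (Fin t)).constr_basis K
      (fun i => (Pi.single i.succ 1 : Fin (t + 1) → K)) j).trans
      (Pi.basisFun_apply K (Fin (t + 1)) j.succ).symm)

theorem cycle_rel_iff (k : ℕ) (i j : Fin (k + 1)) :
    (cycle (k + 1)).rel i j ↔ i + 1 = j := by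
  rw [Fin.ext_iff, Fin.val_add]
  simp only [Fin.val_one', Nat.add_mod_mod]
  rfl

/-- The edges of the cycle with `k + 1` vertices. -/
def cycleEdge (k : ℕ) : Fin (k + 1) ≃ (cycle (k + 1)).Edge where
  toFun j := ⟨(j, j + 1), (cycle_rel_iff k _ _).2 rfl⟩
  invFun e := e.1.1
  left_inv _ := rfl
  right_inv e := Subtype.ext (Prod.ext rfl ((cycle_rel_iff k _ _).1 e.2))

/-- The linearization of the cycle with `k + 1` vertices is `S(X^{k+1} - 1)`. -/
theorem nonempty_linearizationCycle (k : ℕ) (hF : (X ^ (k + 1) - 1 : K[X]).Monic) :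
    Nonempty (TsfPair.Iso ((cycle (k + 1)).linearization K) (sType (X ^ (k + 1) - 1) hF)) := by
  have hdeg : (X ^ (k + 1) - 1 : K[X]).natDegree = k + 1 := natDegree_X_pow_sub_C
  have hroot : AdjoinRoot.root (X ^ (k + 1) - 1 : K[X]) ^ (k + 1) = 1 := by
    have h := AdjoinRoot.mk_self (f := (X ^ (k + 1) - 1 : K[X]))
    rw [map_sub, map_pow, AdjoinRoot.mk_X, map_one] at h
    exact sub_eq_zero.1 h
  -- The powers of the root are listed in descending order, so that multiplication by `X` lowers the
  -- index by one, cyclically because `X^{k+1} = 1`.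
  let B : Module.Basis (Fin (k + 1)) K (AdjoinRoot (X ^ (k + 1) - 1 : K[X])) :=
    (AdjoinRoot.powerBasis' hF).basis.reindex ((finCongr hdeg).trans Fin.revPerm)
  have hB : ∀ i : Fin (k + 1), B i = AdjoinRoot.root (X ^ (k + 1) - 1 : K[X]) ^ (k - i : ℕ) := by
    intro i
    have h1 : B i = AdjoinRoot.root (X ^ (k + 1) - 1 : K[X]) ^ (i.rev : ℕ) :=
      (Module.Basis.reindex_apply _ _ i).trans ((AdjoinRoot.powerBasis' hF).basis_eq_pow _)
    rw [h1, Fin.val_rev]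
    congr 1
    omega
  have hBr : ∀ j, B.reindex (Equiv.addRight 1).symm j = B (j + 1) := fun j =>
    Module.Basis.reindex_apply _ _ _
  have hmul : ∀ j, AdjoinRoot.root (X ^ (k + 1) - 1 : K[X]) * B (j + 1) = B j := by
    intro j
    rw [hB, hB, ← pow_succ', Fin.val_add_one]
    split_ifs with h
    · subst h
      simp [hroot]
    · have h1 : (j : ℕ) < k := Fin.val_lt_last h
      congr 1
      omega
  -- As `ν` is the identity, an edge must be represented by the basis vector of its target `j + 1`;
  -- hence the shifted basis on the domain.
  exact ⟨Iso.ofBases (K := K) (ι := Fin (k + 1)) (κ := Fin (k + 1)) id (fun j => j + 1)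
    (edgeBasis K (cycleEdge k)) (B.reindex (Equiv.addRight 1).symm)
    (vertexBasis K (cycle (k + 1))) B
    (linearization_μ_edgeBasis K (cycleEdge k))
    (fun j => (congrArg (fun x => AdjoinRoot.root _ * x) (hBr j)).trans (hmul j))
    (linearization_ν_edgeBasis K (cycleEdge k)) hBr⟩

end BinRel

namespace TsfPair

variable {K : Type u} [Field K]

theorem sType_ν_bijective (F : K[X]) (hF : F.Monic) : Function.Bijective (sType F hF).ν :=
  Function.bijective_id

/-- In a Bézout relation `a X + b F = 1`, the class of `a` is inverse to the root. -/
theorem sType_μ_bijective (F : K[X]) (hF : F.Monic) (h : IsCoprime X F) :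
    Function.Bijective (sType F hF).μ := by
  obtain ⟨a, b, hab⟩ := h
  have h1 : AdjoinRoot.mk F a * AdjoinRoot.root F = 1 := by
    have h2 := congrArg (AdjoinRoot.mk F) hab
    rwa [map_add, map_mul, map_mul, AdjoinRoot.mk_self, mul_zero, add_zero, AdjoinRoot.mk_X,
      map_one] at h2
  change Function.Bijective fun x => AdjoinRoot.root F * x
  refine Function.bijective_iff_has_inverse.2 ⟨fun x => AdjoinRoot.mk F a * x, fun x => ?_,
    fun x => ?_⟩
  · change AdjoinRoot.mk F a * (AdjoinRoot.root F * x) = x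
    rw [← mul_assoc, h1, one_mul]
  · change AdjoinRoot.root F * (AdjoinRoot.mk F a * x) = x
    rw [← mul_assoc, mul_comm (AdjoinRoot.root F), h1, one_mul]

theorem isCoprime_X_X_pow_sub_one {n : ℕ} (hn : 1 ≤ n) : IsCoprime X (X ^ n - 1 : K[X]) := by
  obtain ⟨k, rfl⟩ := Nat.exists_eq_add_of_le' hn
  exact ⟨X ^ k, -1, by ring⟩

end TsfPair

namespace BinRel

open TsfPair

variable (K : Type u) [Field K]

/-- The linearization of a binary relation is the direct sum of the `T_{m_i - 1}`, the
`S(X^{n_j} - 1)` and null types. -/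
theorem isSumWithNull_linearization (Γ : BinRel.{v}) [Finite Γ.carrier]
    (p q : ℕ) (m : Fin p → ℕ) (n : Fin q → ℕ) (hm : ∀ i, 1 ≤ m i)
    (hn : ∀ j, 1 ≤ n j) (hF : ∀ j, (X ^ n j - 1 : K[X]).Monic)
    (hΓ : Nonempty (Iso Γ.cStabilization (disjointUnion
      (Sum.elim (fun i : Fin p => path (m i)) (fun j : Fin q => cycle (n j)))))) :
    IsSumWithNull (Sum.elim (fun i => tType K (m i - 1)) (fun j => sType (X ^ n j - 1) (hF j)))
      (Γ.linearization K) := by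
  obtain ⟨e⟩ := hΓ
  have hfin : ∀ k, Finite
      ((Sum.elim (fun i : Fin p => path (m i)) (fun j : Fin q => cycle (n j))) k).carrier := by
    rintro (i | j)
    · exact inferInstanceAs (Finite (path (m i)).carrier)
    · exact inferInstanceAs (Finite (cycle (n j)).carrier)
  have h1 : Finite (disjointUnion
      (Sum.elim (fun i : Fin p => path (m i)) (fun j : Fin q => cycle (n j)))).carrier :=
    inferInstanceAs (Finite (Σ k,
      ((Sum.elim (fun i : Fin p => path (m i)) (fun j : Fin q => cycle (n j))) k).carrier))
  have h2 : Finite Γ.cStabilization.carrier := Finite.of_equiv _ e.toEquiv.symm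
  refine isSumWithNull_of_cStabilization ?_ ?_ Γ ?_
  · rintro (i | j)
    · exact tType_μ_injective _
    · exact (sType_μ_bijective _ (hF j) (isCoprime_X_X_pow_sub_one (hn j))).injective
  · rintro (i | j)
    · exact tType_ν_injective _
    · exact (sType_ν_bijective _ (hF j)).injective
  · have h3 : ∀ k, Nonempty (TsfPair.Iso
        (((Sum.elim (fun i : Fin p => path (m i)) (fun j : Fin q => cycle (n j))) k).linearization
          K)
        (Sum.elim (fun i => tType K (m i - 1)) (fun j => sType (X ^ n j - 1) (hF j)) k)) := by
      rintro (i | j)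
      · obtain ⟨t, ht⟩ := Nat.exists_eq_add_of_le' (hm i)
        change Nonempty (TsfPair.Iso ((path (m i)).linearization K) (tType K (m i - 1)))
        rw [ht]
        exact ⟨linearizationPath K t⟩
      · obtain ⟨k, hk⟩ := Nat.exists_eq_add_of_le' (hn j)
        have h4 := hF j
        change Nonempty (TsfPair.Iso ((cycle (n j)).linearization K)
          (sType (X ^ n j - 1) h4))
        revert h4
        rw [hk]
        exact fun h4 => nonempty_linearizationCycle K k h4
    have e1 := (linearizationCongr K e).trans (linearizationDisjointUnion K _)
    have e2 := e1.trans (Iso.directSum fun k => (h3 k).some)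
    -- The stabilization itself has no null summands, so the induction starts from an empty family.
    obtain ⟨e3⟩ := nonempty_iso_directSum_reindex (K := K) (Equiv.sumEmpty (Fin p ⊕ Fin q) Empty)
      (P := Sum.elim (Sum.elim (fun i => tType K (m i - 1)) (fun j => sType (X ^ n j - 1) (hF j)))
        fun j : Empty => (j.elim : NullType).toPair K)
      (Q := Sum.elim (fun i => tType K (m i - 1)) (fun j => sType (X ^ n j - 1) (hF j))) (by
        rintro (k | j)
        · exact ⟨Iso.refl _⟩
        · exact j.elim)
    exact ⟨Empty, inferInstance, fun j => j.elim, ⟨e2.trans e3.symm⟩⟩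

end BinRel

/-! ### Splitting `S(F)` into primary parts, and existence -/

namespace TsfPair

variable {K : Type u} [Field K]

theorem finrank_adjoinRoot (F : K[X]) (hF : F.Monic) :
    Module.finrank K (AdjoinRoot F) = F.natDegree :=
  (AdjoinRoot.powerBasis' hF).finrank

/-- The Chinese remainder theorem for `S(F)`. -/
theorem nonempty_sType_iso_of_prod {ι : Type w} [Fintype ι] (G : ι → K[X]) (hG : ∀ i, (G i).Monic)
    (hcop : Pairwise (Function.onFun IsCoprime G)) (F : K[X]) (hF : F.Monic) (h : ∏ i, G i = F) :
    Nonempty (Iso (sType F hF) (directSum fun i => sType (G i) (hG i))) := by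
  have hdvd : ∀ i, G i ∣ F := fun i => h ▸ Finset.dvd_prod_of_mem G (Finset.mem_univ i)
  have hfin : ∀ i, Module.Finite K (AdjoinRoot (G i)) := fun i => (hG i).finite_adjoinRoot
  have hfin' : Module.Finite K (AdjoinRoot F) := hF.finite_adjoinRoot
  let φ : AdjoinRoot F →ₗ[K] ∀ i, AdjoinRoot (G i) :=
    LinearMap.pi fun i => (AdjoinRoot.algHomOfDvd K F (G i) (hdvd i)).toLinearMap
  have hφ : ∀ i f, φ (AdjoinRoot.mk F f) i = AdjoinRoot.mk (G i) f := by
    intro i f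
    change AdjoinRoot.algHomOfDvd K F (G i) (hdvd i) (AdjoinRoot.mk F f) = _
    rw [← AdjoinRoot.aeval_eq, ← Polynomial.aeval_algHom_apply, AdjoinRoot.algHomOfDvd_root,
      AdjoinRoot.aeval_eq]
  have hinj : Function.Injective φ := by
    rw [← LinearMap.ker_eq_bot, LinearMap.ker_eq_bot']
    intro x hx
    obtain ⟨f, rfl⟩ := AdjoinRoot.mk_surjective x
    rw [AdjoinRoot.mk_eq_zero, ← h]
    refine Fintype.prod_dvd_of_coprime hcop fun i => ?_
    rw [← AdjoinRoot.mk_eq_zero, ← hφ, hx]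
    rfl
  have hdim : Module.finrank K (AdjoinRoot F) = Module.finrank K (∀ i, AdjoinRoot (G i)) := by
    rw [Module.finrank_pi_fintype, finrank_adjoinRoot F hF, ← h,
      natDegree_prod_of_monic _ _ fun i _ => hG i]
    exact Finset.sum_congr rfl fun i _ => (finrank_adjoinRoot (G i) (hG i)).symm
  let e := LinearEquiv.ofInjectiveOfFinrankEq φ hinj hdim
  have hmul : ∀ i (x : AdjoinRoot F), AdjoinRoot.root (G i) *
      AdjoinRoot.algHomOfDvd K F (G i) (hdvd i) x =
        AdjoinRoot.algHomOfDvd K F (G i) (hdvd i) (AdjoinRoot.root F * x) := by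
    intro i x
    rw [map_mul, AdjoinRoot.algHomOfDvd_root]
  exact ⟨⟨e, e, fun x => funext fun i => hmul i x, fun x => rfl⟩⟩

theorem exists_isKroneckerDecomposition_of_finite {π : TsfPair.{u, v} K} {ι : Type w} [Finite ι]
    (κ : ι → KroneckerType K) (h : Nonempty (Iso π (directSum fun i => (κ i).toPair))) :
    ∃ (r : ℕ) (κ : Fin r → KroneckerType K), π.IsKroneckerDecomposition κ := by
  obtain ⟨e⟩ := h
  obtain ⟨r, ⟨f⟩⟩ := Finite.exists_equiv_fin ι
  obtain ⟨e'⟩ := nonempty_iso_directSum_reindex (K := K) f (P := fun i => (κ i).toPair)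
    (Q := fun i => (κ (f.symm i)).toPair) fun i => by
      rw [f.symm_apply_apply]
      exact ⟨Iso.refl _⟩
  exact ⟨r, fun i => κ (f.symm i), ⟨e.trans e'⟩⟩

theorem exists_isKroneckerDecomposition_of_type (κ : KroneckerType K) :
    ∃ (r : ℕ) (κ' : Fin r → KroneckerType K), κ.toPair.IsKroneckerDecomposition κ' := by
  refine exists_isKroneckerDecomposition_of_finite (ι := Unit) (fun _ => κ) ⟨Iso.symm
    ⟨LinearEquiv.funUnique Unit K κ.toPair.E, LinearEquiv.funUnique Unit K κ.toPair.V,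
      fun _ => rfl, fun _ => rfl⟩⟩

theorem exists_isKroneckerDecomposition_of_directSum {π : TsfPair.{u, v} K} {ι : Type w} [Finite ι]
    {P : ι → TsfPair.{u, v₁} K} (e : Iso π (directSum P))
    (h : ∀ i, ∃ (r : ℕ) (κ : Fin r → KroneckerType K), (P i).IsKroneckerDecomposition κ) :
    ∃ (r : ℕ) (κ : Fin r → KroneckerType K), π.IsKroneckerDecomposition κ := by
  choose r κ f using h
  exact exists_isKroneckerDecomposition_of_finite (fun x : Σ i, Fin (r i) => κ x.1 x.2)
    ⟨(e.trans (Iso.directSum fun i => (f i).some)).trans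
      (Iso.sigma fun i j => (κ i j).toPair).symm⟩

/-- `S(F)` is the direct sum of the `S(p^n)` for the prime powers dividing `F` exactly. -/
theorem exists_isKroneckerDecomposition_sType (F : K[X]) (hF : F.Monic) (hX : IsCoprime X F) :
    ∃ (r : ℕ) (κ : Fin r → KroneckerType K), (sType F hF).IsKroneckerDecomposition κ := by
  classical
  let s := UniqueFactorizationMonoid.normalizedFactors F
  have hs : ∀ p ∈ s, Irreducible p ∧ p.Monic ∧ p ∣ F := fun p hp =>
    (Polynomial.mem_normalizedFactors_iff hF.ne_zero).1 hp
  have hs' : ∀ p : s.toFinset, Irreducible p.1 ∧ p.1.Monic ∧ p.1 ∣ F := fun p =>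
    hs p.1 (Multiset.mem_toFinset.1 p.2)
  have hprod : ∏ p : s.toFinset, p.1 ^ s.count p.1 = F := by
    rw [Finset.prod_coe_sort s.toFinset fun p => p ^ s.count p, ← Finset.prod_multiset_count,
      ← leadingCoeff_mul_prod_normalizedFactors F, hF.leadingCoeff, C_1, one_mul]
  have hcop : Pairwise (Function.onFun IsCoprime fun p : s.toFinset => p.1 ^ s.count p.1) := by
    intro p p' hne
    refine IsCoprime.pow (((hs' p).1.coprime_iff_not_dvd).2 fun hd => hne (Subtype.ext ?_))
    exact eq_of_monic_of_associated (hs' p).2.1 (hs' p').2.1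
      ((hs' p).1.associated_of_dvd (hs' p').1 hd)
  obtain ⟨e⟩ := nonempty_sType_iso_of_prod _ (fun p => (hs' p).2.1.pow _) hcop F hF hprod
  refine exists_isKroneckerDecomposition_of_finite (fun p : s.toFinset =>
    KroneckerType.sType p.1 (s.count p.1) (hs' p).2.1 (hs' p).1 ?_
      (Multiset.one_le_count_iff_mem.2 (Multiset.mem_toFinset.1 p.2))) ⟨e⟩
  intro hp
  exact (hs' p).1.not_isUnit ((hX.isUnit_of_dvd' (hp ▸ dvd_refl _) (hs' p).2.2))

end TsfPair

/-- A null type as a member of Kronecker's list. -/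
def NullType.toKroneckerType (K : Type u) [Field K] : NullType → KroneckerType K
  | .zeroT n => .zeroT (n + 1) (Nat.le_add_left _ _)
  | .tZero n => .tZero (n + 1) (Nat.le_add_left _ _)
  | .zeroTZero n => .zeroTZero n

theorem NullType.toPair_toKroneckerType (K : Type u) [Field K] (c : NullType) :
    (c.toKroneckerType K).toPair = c.toPair K := by
  cases c <;> rfl

namespace TsfPair

variable {K : Type u} [Field K]

theorem IsSumWithNull.exists_isKroneckerDecomposition {I : Type} [Finite I]
    {A : I → TsfPair.{u, u} K} {π : TsfPair.{u, v} K} (h : IsSumWithNull A π)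
    (hA : ∀ i, ∃ (r : ℕ) (κ : Fin r → KroneckerType K), (A i).IsKroneckerDecomposition κ) :
    ∃ (r : ℕ) (κ : Fin r → KroneckerType K), π.IsKroneckerDecomposition κ := by
  obtain ⟨J, hJ, c, ⟨e⟩⟩ := h
  refine exists_isKroneckerDecomposition_of_directSum e ?_
  rintro (i | j)
  · exact hA i
  · rw [Sum.elim_inr, ← NullType.toPair_toKroneckerType]
    exact exists_isKroneckerDecomposition_of_type _

end TsfPair

/-! ### Homomorphisms, and inclusions and projections of direct sums -/

namespace TsfPair

variable {K : Type u} [Field K]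

section ExtendZero

variable {ι : Type w}

open Classical in
/-- Extension by zero of a family indexed by a subtype. -/
noncomputable def extendZero (s : ι → Prop) (M : ι → Type v) [∀ i, AddCommGroup (M i)]
    [∀ i, Module K (M i)] : (∀ i : {i // s i}, M i.1) →ₗ[K] ∀ i, M i :=
  LinearMap.pi fun i => if h : s i then LinearMap.proj (⟨i, h⟩ : {i // s i}) else 0

theorem extendZero_of_pos (s : ι → Prop) (M : ι → Type v) [∀ i, AddCommGroup (M i)]
    [∀ i, Module K (M i)] (x : ∀ i : {i // s i}, M i.1) (i : ι) (h : s i) :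
    extendZero (K := K) s M x i = x ⟨i, h⟩ := by
  simp [extendZero, h]

theorem extendZero_of_neg (s : ι → Prop) (M : ι → Type v) [∀ i, AddCommGroup (M i)]
    [∀ i, Module K (M i)] (x : ∀ i : {i // s i}, M i.1) (i : ι) (h : ¬ s i) :
    extendZero (K := K) s M x i = 0 := by
  simp [extendZero, h]

theorem map_extendZero (s : ι → Prop) (M N : ι → Type v) [∀ i, AddCommGroup (M i)]
    [∀ i, Module K (M i)] [∀ i, AddCommGroup (N i)] [∀ i, Module K (N i)]
    (φ : ∀ i, M i →ₗ[K] N i) (x : ∀ i : {i // s i}, M i.1) (i : ι) :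
    φ i (extendZero (K := K) s M x i) = extendZero (K := K) s N (fun i => φ i.1 (x i)) i := by
  by_cases h : s i
  · rw [extendZero_of_pos s M x i h, extendZero_of_pos s N _ i h]
  · rw [extendZero_of_neg s M x i h, extendZero_of_neg s N _ i h, map_zero]

end ExtendZero

/-- A homomorphism of transformation-pairs. -/
structure Hom (π : TsfPair.{u, v} K) (π' : TsfPair.{u, w} K) where
  f : π.E →ₗ[K] π'.E
  g : π.V →ₗ[K] π'.V
  comm_μ : ∀ x, π'.μ (f x) = g (π.μ x)
  comm_ν : ∀ x, π'.ν (f x) = g (π.ν x)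

/-- The homomorphism underlying an isomorphism. -/
def Iso.toHom {π : TsfPair.{u, v} K} {π' : TsfPair.{u, w} K} (e : Iso π π') : Hom π π' where
  f := e.α
  g := e.β
  comm_μ := e.comm_μ
  comm_ν := e.comm_ν

namespace Hom

/-- Composition of homomorphisms. -/
def comp {π : TsfPair.{u, v₁} K} {π' : TsfPair.{u, v₂} K} {π'' : TsfPair.{u, v₃} K}
    (h' : Hom π' π'') (h : Hom π π') : Hom π π'' where
  f := h'.f ∘ₗ h.f
  g := h'.g ∘ₗ h.g
  comm_μ x := by simp [h.comm_μ, h'.comm_μ]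
  comm_ν x := by simp [h.comm_ν, h'.comm_ν]

/-- Exchanging the two maps in a homomorphism. -/
def swap {π : TsfPair.{u, v} K} {π' : TsfPair.{u, w} K} (h : Hom π π') : Hom π.swap π'.swap where
  f := h.f
  g := h.g
  comm_μ := h.comm_ν
  comm_ν := h.comm_μ

variable {ι : Type w} [Finite ι] (P : ι → TsfPair.{u, v} K)

/-- The projection of a direct sum onto a summand. -/
def proj (i : ι) : Hom (directSum P) (P i) where
  f := (LinearMap.proj i : (∀ i, (P i).E) →ₗ[K] (P i).E)
  g := (LinearMap.proj i : (∀ i, (P i).V) →ₗ[K] (P i).V)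
  comm_μ _ := rfl
  comm_ν _ := rfl

/-- The projection of a direct sum onto a partial sum. -/
def restrict (s : ι → Prop) : Hom (directSum P) (directSum fun i : {i // s i} => P i.1) where
  f := (LinearMap.pi fun i => LinearMap.proj i.1 :
    (∀ i, (P i).E) →ₗ[K] ∀ i : {i // s i}, (P i.1).E)
  g := (LinearMap.pi fun i => LinearMap.proj i.1 :
    (∀ i, (P i).V) →ₗ[K] ∀ i : {i // s i}, (P i.1).V)
  comm_μ _ := rfl
  comm_ν _ := rfl

/-- The inclusion of a partial sum into a direct sum. -/
noncomputable def extend (s : ι → Prop) :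
    Hom (directSum fun i : {i // s i} => P i.1) (directSum P) where
  f := extendZero s fun i => (P i).E
  g := extendZero s fun i => (P i).V
  comm_μ x := funext fun i => map_extendZero s _ _ (fun i => (P i).μ) x i
  comm_ν x := funext fun i => map_extendZero s _ _ (fun i => (P i).ν) x i

/-- The inclusion of a summand into a direct sum. -/
def single [DecidableEq ι] (i : ι) : Hom (P i) (directSum P) where
  f := LinearMap.single K (fun i => (P i).E) i
  g := LinearMap.single K (fun i => (P i).V) i
  comm_μ x := funext fun j => by
    change (P j).μ (Pi.single (M := fun i => (P i).E) i x j) =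
      Pi.single (M := fun i => (P i).V) i ((P i).μ x) j
    rcases eq_or_ne j i with rfl | hj
    · rw [Pi.single_eq_same, Pi.single_eq_same]
    · rw [Pi.single_eq_of_ne hj, Pi.single_eq_of_ne hj, map_zero]
  comm_ν x := funext fun j => by
    change (P j).ν (Pi.single (M := fun i => (P i).E) i x j) =
      Pi.single (M := fun i => (P i).V) i ((P i).ν x) j
    rcases eq_or_ne j i with rfl | hj
    · rw [Pi.single_eq_same, Pi.single_eq_same]
    · rw [Pi.single_eq_of_ne hj, Pi.single_eq_of_ne hj, map_zero]

end Hom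

/-! ### The subspaces that are removed by contractions, and the domains of iterates -/

/-- The vectors reached from `0` in `k` steps of the linear relation defined by `π`. -/
def leftNull (π : TsfPair.{u, v} K) : ℕ → Submodule K π.V
  | 0 => ⊥
  | k + 1 => ((leftNull π k).comap π.μ).map π.ν

/-- The vectors from which `0` is reached, or which are reached from `0`, in `k` steps of the
linear relation defined by `π`. -/
def nullSpace (π : TsfPair.{u, v} K) (k : ℕ) : Submodule K π.V :=
  leftNull π k ⊔ leftNull π.swap k

/-- The vectors from which `t` steps of the linear relation defined by `π` are possible. -/
def iterDomain (π : TsfPair.{u, v} K) : ℕ → Submodule K π.V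
  | 0 => ⊤
  | t + 1 => ((iterDomain π t).comap π.ν).map π.μ

section Functoriality

variable {π : TsfPair.{u, v} K} {π' : TsfPair.{u, w} K}

theorem Hom.map_leftNull (h : Hom π π') (k : ℕ) {x : π.V} (hx : x ∈ leftNull π k) :
    h.g x ∈ leftNull π' k := by
  induction k generalizing x with
  | zero =>
    rw [leftNull, Submodule.mem_bot] at hx ⊢
    rw [hx, map_zero]
  | succ k ih =>
    obtain ⟨e, he, rfl⟩ := hx
    exact ⟨h.f e, by simpa [h.comm_μ] using ih he, h.comm_ν e⟩

theorem Hom.map_nullSpace (h : Hom π π') (k : ℕ) {x : π.V} (hx : x ∈ nullSpace π k) :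
    h.g x ∈ nullSpace π' k := by
  obtain ⟨y, hy, z, hz, rfl⟩ := Submodule.mem_sup.1 hx
  rw [map_add]
  exact Submodule.add_mem_sup (h.map_leftNull k hy) (h.swap.map_leftNull k hz)

theorem Hom.map_iterDomain (h : Hom π π') (t : ℕ) {x : π.V} (hx : x ∈ iterDomain π t) :
    h.g x ∈ iterDomain π' t := by
  induction t generalizing x with
  | zero => exact Submodule.mem_top
  | succ t ih =>
    obtain ⟨e, he, rfl⟩ := hx
    exact ⟨h.f e, by simpa [h.comm_ν] using ih he, h.comm_μ e⟩

theorem Hom.map_sup (h : Hom π π') (t k : ℕ) {x : π.V}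
    (hx : x ∈ iterDomain π t ⊔ nullSpace π k) : h.g x ∈ iterDomain π' t ⊔ nullSpace π' k := by
  obtain ⟨y, hy, z, hz, rfl⟩ := Submodule.mem_sup.1 hx
  rw [map_add]
  exact Submodule.add_mem_sup (h.map_iterDomain t hy) (h.map_nullSpace k hz)

end Functoriality

/-- The dimension of the space of vectors from which `t` steps are possible, up to the null space. -/
noncomputable def iterDim (π : TsfPair.{u, v} K) (k t : ℕ) : ℕ :=
  Module.finrank K (iterDomain π t ⊔ nullSpace π k : Submodule K π.V)

theorem Iso.iterDim_eq {π : TsfPair.{u, v} K} {π' : TsfPair.{u, w} K} (e : Iso π π') (k t : ℕ) :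
    iterDim π k t = iterDim π' k t := by
  refine LinearEquiv.finrank_eq (LinearEquiv.ofSubmodules e.β _ _ ?_)
  refine le_antisymm ?_ fun y hy => ?_
  · rintro _ ⟨x, hx, rfl⟩
    exact e.toHom.map_sup t k hx
  · exact ⟨e.β.symm y, e.symm.toHom.map_sup t k hy, e.β.apply_symm_apply y⟩

section DirectSum

variable {ι : Type w} [Finite ι] (P : ι → TsfPair.{u, v} K)

/-- Together with functoriality under projections, this splits a functorial subspace along a direct
sum. The decidability of equality needed by `Hom.single` is quantified inside `h`, so that the
statement commits to no instance. -/
theorem mem_of_forall_mem (W : Submodule K (directSum P).V) (W' : ∀ i, Submodule K (P i).V)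
    (h : ∀ [DecidableEq ι], ∀ i x, x ∈ W' i → (Hom.single P i).g x ∈ W) (y : (directSum P).V)
    (hy : ∀ i, (Hom.proj P i).g y ∈ W' i) : y ∈ W := by
  classical
  have := Fintype.ofFinite ι
  have h1 : y = ∑ i, (Hom.single P i).g ((Hom.proj P i).g y) :=
    (Finset.univ_sum_single (M := fun i => (P i).V) y).symm
  rw [h1]
  exact Submodule.sum_mem _ fun i _ => h i _ (hy i)

theorem finrank_directSum_submodule [Fintype ι] (W : Submodule K (directSum P).V)
    (W' : ∀ i, Submodule K (P i).V)
    (hW : ∀ y, y ∈ W ↔ ∀ i, (Hom.proj P i).g y ∈ W' i) :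
    Module.finrank K W = ∑ i, Module.finrank K (W' i) := by
  rw [← Module.finrank_pi_fintype]
  let φ : W →ₗ[K] ∀ i, W' i := LinearMap.pi fun i =>
    ((Hom.proj P i).g ∘ₗ W.subtype).codRestrict (W' i) fun y => (hW y.1).1 y.2 i
  refine LinearEquiv.finrank_eq (LinearEquiv.ofBijective φ ⟨fun x y hxy => ?_, fun y => ?_⟩)
  · exact Subtype.ext (funext fun i => congrArg Subtype.val (congrFun hxy i))
  · exact ⟨⟨(fun i => (y i).1 : ∀ i, (P i).V), (hW _).2 fun i => (y i).2⟩, rfl⟩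

theorem iterDim_directSum [Fintype ι] (k t : ℕ) :
    iterDim (directSum P) k t = ∑ i, iterDim (P i) k t :=
  finrank_directSum_submodule P _ _ fun y => ⟨fun hy i => (Hom.proj P i).map_sup t k hy,
    mem_of_forall_mem P _ _ (fun i _ hx => (Hom.single P i).map_sup t k hx) y⟩

end DirectSum

/-! ### The regular part -/

/-- `A` is the regular part of `π`: the summands of `π` on which both maps are bijective. -/
structure RegularPart (k : ℕ) (π : TsfPair.{u, v} K) (A : TsfPair.{u, w} K) where
  i : Hom A π
  p : Hom π A
  p_i : ∀ x, p.g (i.g x) = x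
  mem_iterDomain : ∀ x, i.g x ∈ iterDomain π k
  p_nullSpace : ∀ y ∈ nullSpace π k, p.g y = 0
  sub_mem : ∀ y ∈ iterDomain π k, y - i.g (p.g y) ∈ nullSpace π k
  ν_bijective : Function.Bijective A.ν

namespace RegularPart

variable {k : ℕ} {π : TsfPair.{u, v} K} {π' : TsfPair.{u, v₁} K} {A : TsfPair.{u, w} K}
  {B : TsfPair.{u, w₁} K}

/-- Transport of the regular part along an isomorphism. -/
def ofIso (r : RegularPart k π A) (e : Iso π π') : RegularPart k π' A where
  i := e.toHom.comp r.i
  p := r.p.comp e.symm.toHom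
  p_i x := by
    change r.p.g (e.β.symm (e.β (r.i.g x))) = x
    rw [LinearEquiv.symm_apply_apply, r.p_i]
  mem_iterDomain x := e.toHom.map_iterDomain k (r.mem_iterDomain x)
  p_nullSpace y hy := r.p_nullSpace _ (e.symm.toHom.map_nullSpace k hy)
  sub_mem y hy := by
    have h1 := e.toHom.map_nullSpace k (r.sub_mem _ (e.symm.toHom.map_iterDomain k hy))
    have h2 : e.toHom.g (e.symm.toHom.g y) = y := e.β.apply_symm_apply y
    rw [map_sub, h2] at h1
    exact h1
  ν_bijective := r.ν_bijective

/-- On `iterDomain`, `r'.i ∘ r'.p` moves a vector only within `nullSpace`, which `r.p` kills. -/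
theorem p_i_p_i (r : RegularPart k π A) (r' : RegularPart k π B) (x : A.V) :
    r.p.g (r'.i.g (r'.p.g (r.i.g x))) = x := by
  have h1 := r.p_nullSpace _ (r'.sub_mem _ (r.mem_iterDomain x))
  rw [map_sub, sub_eq_zero, r.p_i] at h1
  exact h1.symm

/-- The codomain of a regular part is `iterDomain` modulo its intersection with `nullSpace`, which
depends on `π` alone. Bijectivity of `ν` transfers the isomorphism from codomains to domains. -/
theorem nonempty_iso (r : RegularPart k π A) (r' : RegularPart k π B) : Nonempty (Iso A B) := by
  let h := r'.p.comp r.i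
  let β : A.V ≃ₗ[K] B.V := LinearEquiv.ofLinearMap h.g (r.p.comp r'.i).g
    (LinearMap.ext fun x => p_i_p_i r' r x) (LinearMap.ext fun x => p_i_p_i r r' x)
  have hβ : ∀ x, β (A.ν x) = B.ν (h.f x) := fun x => (h.comm_ν x).symm
  have hf : Function.Bijective h.f := by
    constructor
    · rw [← LinearMap.ker_eq_bot, LinearMap.ker_eq_bot']
      intro x hx
      have h1 := hβ x
      rw [hx, map_zero, LinearEquiv.map_eq_zero_iff] at h1
      exact r.ν_bijective.injective (h1.trans (map_zero _).symm)
    · intro y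
      obtain ⟨x, hx⟩ := r.ν_bijective.surjective (β.symm (B.ν y))
      refine ⟨x, r'.ν_bijective.injective ?_⟩
      rw [← hβ, hx, LinearEquiv.apply_symm_apply]
  exact ⟨⟨LinearEquiv.ofBijective h.f hf, β, h.comm_μ, h.comm_ν⟩⟩

end RegularPart

/-! ### Kinds of summands -/

/-- The three kinds of summands that the `C`-stabilization distinguishes. -/
inductive Kind : Type
  | null
  | regular
  | path (n : ℕ)

/-- `π` behaves like a null type, like some `S(F)` with `F(0) ≠ 0`, or like `T_n`, as seen in `k`
steps. -/
def IsOfKind (k : ℕ) (π : TsfPair.{u, v} K) : Kind → Prop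
  | .null => nullSpace π k = ⊤
  | .regular => nullSpace π k = ⊥ ∧ (∀ t, iterDomain π t = ⊤) ∧ Function.Bijective π.ν
  | .path n => n < k ∧ nullSpace π k = ⊥ ∧ ∀ t, Module.finrank K (iterDomain π t) = n + 1 - t

/-- For null and regular kinds the dimension does not depend on `t`. For `T_n` it is `max (n + 1 -
t, 0)`, a piecewise linear function whose only kink, at `t = n + 1`, is seen by the forward second
difference at `n`. -/
theorem IsOfKind.iterDim {k : ℕ} {π : TsfPair.{u, v} K} {d : Kind} (h : IsOfKind k π d) (t : ℕ) :
    (iterDim π k t : ℤ) - 2 * iterDim π k (t + 1) + iterDim π k (t + 2) =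
      open Classical in if d = Kind.path t then 1 else 0 := by
  cases d with
  | null =>
    have h1 : ∀ t, TsfPair.iterDim π k t = Module.finrank K (⊤ : Submodule K π.V) := fun t => by
      rw [TsfPair.iterDim, show nullSpace π k = ⊤ from h, sup_top_eq]
    simp only [h1, reduceCtorEq, if_false]
    ring
  | regular =>
    have h1 : ∀ t, TsfPair.iterDim π k t = Module.finrank K (⊤ : Submodule K π.V) := fun t => by
      rw [TsfPair.iterDim, h.2.1, top_sup_eq]
    simp only [h1, reduceCtorEq, if_false]
    ring
  | path n =>
    have h1 : ∀ t, TsfPair.iterDim π k t = n + 1 - t := fun t => by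
      rw [TsfPair.iterDim, h.2.1, sup_bot_eq, h.2.2]
    simp only [h1, Kind.path.injEq]
    split_ifs <;> omega

section DirectSum

variable {k : ℕ} {ι : Type w} [Finite ι] {P : ι → TsfPair.{u, v} K} {d : ι → Kind}

theorem card_path (h : ∀ i, IsOfKind k (P i) (d i)) (t : ℕ) :
    (Nat.card {i // d i = Kind.path t} : ℤ) = iterDim (directSum P) k t -
      2 * iterDim (directSum P) k (t + 1) + iterDim (directSum P) k (t + 2) := by
  classical
  have := Fintype.ofFinite ι
  rw [iterDim_directSum, iterDim_directSum, iterDim_directSum, Nat.card_eq_fintype_card,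
    Fintype.card_subtype, Finset.card_filter]
  push_cast
  rw [Finset.mul_sum, ← Finset.sum_sub_distrib, ← Finset.sum_add_distrib]
  exact Finset.sum_congr rfl fun i _ => by
    rw [(h i).iterDim t]

/-- In a null pair everything is null, and for `T_n` with `n < k` only the zero vector admits `k`
steps. So only regular summands survive in the quotient. -/
theorem IsOfKind.iterDomain_le {π : TsfPair.{u, v} K} {d : Kind} (h : IsOfKind k π d)
    (hd : d ≠ Kind.regular) : iterDomain π k ≤ nullSpace π k := by
  cases d with
  | null => exact le_top.trans (show nullSpace π k = ⊤ from h).ge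
  | regular => exact absurd rfl hd
  | path n =>
    have h1 := h.1
    have h2 := h.2.2 k
    rw [show n + 1 - k = 0 by omega, Submodule.finrank_eq_zero] at h2
    rw [h2]
    exact bot_le

theorem iterDomain_directSum_of_regular (h : ∀ i, iterDomain (P i) k = ⊤) (x : (directSum P).V) :
    x ∈ iterDomain (directSum P) k :=
  mem_of_forall_mem P _ (fun i => iterDomain (P i) k)
    (fun i _ hx => (Hom.single P i).map_iterDomain k hx) x fun i => by
      rw [h i]
      exact Submodule.mem_top

/-- The regular part of a direct sum consists of the summands of regular kind. -/
noncomputable def regularPart (h : ∀ i, IsOfKind k (P i) (d i)) :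
    RegularPart k (directSum P) (directSum fun i : {i // d i = Kind.regular} => P i.1) where
  i := Hom.extend P fun i => d i = Kind.regular
  p := Hom.restrict P fun i => d i = Kind.regular
  p_i x := funext fun i =>
    extendZero_of_pos (K := K) (fun i => d i = Kind.regular) (fun i => (P i).V) x i.1 i.2
  mem_iterDomain x := by
    refine Hom.map_iterDomain _ k (iterDomain_directSum_of_regular (fun i => ?_) x)
    have h1 := h i.1
    rw [i.2] at h1
    exact h1.2.1 k
  p_nullSpace y hy := funext fun i => by
    have h1 := h i.1
    rw [i.2] at h1
    have h2 := (Hom.proj P i.1).map_nullSpace k hy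
    rw [h1.1] at h2
    exact h2
  sub_mem y hy := by
    refine mem_of_forall_mem P _ (fun i => nullSpace (P i) k)
      (fun i _ hx => (Hom.single P i).map_nullSpace k hx) _ fun i => ?_
    let s : ι → Prop := fun i => d i = Kind.regular
    change (Hom.proj P i).g y -
      extendZero (K := K) s (fun i => (P i).V) (fun i => (Hom.proj P i.1).g y) i ∈ _
    by_cases hi : s i
    · rw [extendZero_of_pos s _ _ i hi, sub_self]
      exact Submodule.zero_mem _
    · rw [extendZero_of_neg s _ _ i hi, sub_zero]
      exact (h i).iterDomain_le hi ((Hom.proj P i).map_iterDomain k hy)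
  ν_bijective := by
    have h1 : ∀ i : {i // d i = Kind.regular}, Function.Bijective (P i.1).ν := fun i => by
      have h1 := h i.1
      rw [i.2] at h1
      exact h1.2.2
    refine ⟨fun x y hxy => funext fun i => (h1 i).injective (congrFun hxy i), fun y => ?_⟩
    choose x hx using fun i => (h1 i).surjective ((y : ∀ i : {i // d i = Kind.regular}, (P i.1).V) i)
    exact ⟨x, funext hx⟩

end DirectSum

/-! ### The kinds of the members of Kronecker's list -/

theorem leftNull_eq_bot {π : TsfPair.{u, v} K} (h : Function.Injective π.μ) (k : ℕ) :
    leftNull π k = ⊥ := by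
  induction k with
  | zero => rfl
  | succ k ih => rw [leftNull, ih, Submodule.comap_bot, LinearMap.ker_eq_bot.2 h, Submodule.map_bot]

theorem nullSpace_eq_bot {π : TsfPair.{u, v} K} (h : Function.Injective π.μ)
    (h' : Function.Injective π.ν) (k : ℕ) : nullSpace π k = ⊥ :=
  eq_bot_iff.2 (sup_le (leftNull_eq_bot h k).le (leftNull_eq_bot (π := π.swap) h' k).le)

theorem iterDomain_eq_top {π : TsfPair.{u, v} K} (h : Function.Surjective π.μ) (t : ℕ) :
    iterDomain π t = ⊤ := by
  induction t with
  | zero => rfl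
  | succ t ih => rw [iterDomain, ih, Submodule.comap_top, Submodule.map_top,
      LinearMap.range_eq_top.2 h]

theorem isOfKind_sType (F : K[X]) (hF : F.Monic) (hX : IsCoprime X F) (k : ℕ) :
    IsOfKind k (sType F hF) Kind.regular :=
  ⟨nullSpace_eq_bot (sType_μ_bijective F hF hX).injective (sType_ν_bijective F hF).injective k,
    iterDomain_eq_top (sType_μ_bijective F hF hX).surjective, sType_ν_bijective F hF⟩

/-- A step leads from the shift of `x` to `x`, so `k` steps from `0` reach all vectors killed by the
`k`-th power of the shift. -/
theorem mem_leftNull_zeroT (n k : ℕ) (x : Fin (n + 1) → K)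
    (hx : ∀ j : Fin (n + 1), (j : ℕ) + k < n + 1 → x j = 0) :
    x ∈ leftNull (zeroT K (n + 1)) k := by
  induction k generalizing x with
  | zero => exact funext fun j => hx j (by omega)
  | succ k ih =>
    refine ⟨x, ih (nilp K (n + 1) x) fun j hj => ?_, rfl⟩
    cases j using Fin.cases with
    | zero => exact nilp_zero n x
    | succ j =>
      rw [nilp_succ]
      refine hx _ ?_
      rw [Fin.val_succ] at hj
      rw [Fin.val_castSucc]
      omega

/-- For `e = (0, x)` one has `ν e = x`, while `μ e` is `x` shifted by one place with its last
coordinate lost; `k` such shifts kill a vector supported on the last `k` coordinates. -/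
theorem mem_leftNull_zeroTZero (n k : ℕ) (x : Fin n → K)
    (hx : ∀ j : Fin n, (j : ℕ) + k < n → x j = 0) : x ∈ leftNull (zeroTZero K n) k := by
  induction k generalizing x with
  | zero => exact funext fun j => hx j (by omega)
  | succ k ih =>
    let e : Fin (n + 1) → K := Fin.cons 0 x
    refine ⟨e, ih ((zeroTZero K n).μ e) fun j hj => ?_, funext fun j => zeroTZero_ν n e j⟩
    rw [zeroTZero_μ]
    cases n with
    | zero => exact j.elim0
    | succ n =>
      cases j using Fin.cases with
      | zero => rfl
      | succ j =>
        refine hx j.castSucc ?_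
        rw [Fin.val_succ] at hj
        rw [Fin.val_castSucc]
        omega

theorem leftNull_zeroT {n k : ℕ} (h : n < k) : leftNull (zeroT K (n + 1)) k = ⊤ :=
  eq_top_iff.2 fun x _ => mem_leftNull_zeroT n k x fun j hj => absurd hj (by omega)

theorem leftNull_zeroTZero {n k : ℕ} (h : n < k) : leftNull (zeroTZero K n) k = ⊤ :=
  eq_top_iff.2 fun x _ => mem_leftNull_zeroTZero n k x fun j hj => absurd hj (by omega)

/-- The vectors of `K^N` whose last `t` coordinates vanish. -/
def lastZero (K : Type u) [Field K] (N t : ℕ) : Submodule K (Fin N → K) where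
  carrier := {x | ∀ j : Fin N, N ≤ (j : ℕ) + t → x j = 0}
  add_mem' hx hy j hj := by simp [hx j hj, hy j hj]
  zero_mem' _ _ := rfl
  smul_mem' c x hx j hj := by simp [hx j hj]

theorem finrank_lastZero (N t : ℕ) : Module.finrank K (lastZero K N t) = N - t := by
  let φ : lastZero K N t →ₗ[K] (Fin (N - t) → K) :=
    LinearMap.funLeft K K (Fin.castLE (Nat.sub_le N t)) ∘ₗ (lastZero K N t).subtype
  have hφ : Function.Bijective φ := by
    constructor
    · rintro ⟨x, hx⟩ ⟨y, hy⟩ hxy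
      refine Subtype.ext (funext fun j => ?_)
      by_cases hj : (j : ℕ) < N - t
      · exact congrFun hxy ⟨j, hj⟩
      · exact (hx j (by omega)).trans (hy j (by omega)).symm
    · intro y
      refine ⟨⟨fun j => if hj : (j : ℕ) < N - t then y ⟨j, hj⟩ else 0, fun j hj => ?_⟩, ?_⟩
      · exact dif_neg (by omega)
      · exact funext fun j => dif_pos j.2
  rw [(LinearEquiv.ofBijective φ hφ).finrank_eq, Module.finrank_fin_fun]

/-- A step moves each coordinate one place up, and is possible exactly when the last coordinate
vanishes. -/
theorem iterDomain_tType (n t : ℕ) : iterDomain (tType K n) t = lastZero K (n + 1) t := by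
  induction t with
  | zero => exact (eq_top_iff.2 fun x _ j hj => absurd hj (by omega)).symm
  | succ t ih =>
    rw [iterDomain, ih]
    refine le_antisymm ?_ fun x hx => ?_
    · rintro _ ⟨e, he, rfl⟩ j hj
      cases j using Fin.lastCases with
      | last => exact tType_μ_last n e
      | cast j =>
        refine (tType_μ_castSucc n e j).trans ((tType_ν_succ n e j).symm.trans (he j.succ ?_))
        rw [Fin.val_castSucc] at hj
        rw [Fin.val_succ]
        omega
    · let x' : Fin (n + 1) → K := x
      have hx' : ∀ j : Fin (n + 1), n + 1 ≤ (j : ℕ) + (t + 1) → x' j = 0 := hx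
      let e : Fin n → K := fun j => x' j.castSucc
      refine ⟨e, fun j hj => ?_, funext fun j => ?_⟩
      · cases j using Fin.cases with
        | zero => exact tType_ν_zero n e
        | succ j =>
          refine (tType_ν_succ n e j).trans (hx' j.castSucc ?_)
          rw [Fin.val_succ] at hj
          rw [Fin.val_castSucc]
          omega
      · cases j using Fin.lastCases with
        | last =>
          refine (tType_μ_last n e).trans (hx' _ ?_).symm
          rw [Fin.val_last]
          omega
        | cast j => exact tType_μ_castSucc n e j

theorem isOfKind_tType {n k : ℕ} (h : n < k) : IsOfKind k (tType K n) (Kind.path n) :=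
  ⟨h, nullSpace_eq_bot (tType_μ_injective n) (tType_ν_injective n) k, fun t => by
    rw [iterDomain_tType]
    exact finrank_lastZero _ _⟩

theorem isOfKind_zeroT {n k : ℕ} (h : n < k) : IsOfKind k (zeroT K (n + 1)) Kind.null :=
  eq_top_iff.2 ((leftNull_zeroT h).ge.trans le_sup_left)

theorem isOfKind_tZero {n k : ℕ} (h : n < k) : IsOfKind k (tZero K (n + 1)) Kind.null :=
  eq_top_iff.2 (le_trans (b := leftNull (tZero K (n + 1)).swap k) (leftNull_zeroT h).ge
    le_sup_right)

theorem isOfKind_zeroTZero {n k : ℕ} (h : n < k) : IsOfKind k (zeroTZero K n) Kind.null :=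
  eq_top_iff.2 ((leftNull_zeroTZero h).ge.trans le_sup_left)

end TsfPair

namespace KroneckerType

open TsfPair Filter

variable {K : Type u} [Field K]

/-- The kind of a member of Kronecker's list. -/
def kind : KroneckerType K → Kind
  | zeroT _ _ => Kind.null
  | tZero _ _ => Kind.null
  | tType n => Kind.path n
  | zeroTZero _ => Kind.null
  | sType _ _ _ _ _ _ => Kind.regular

theorem kind_eq_path_iff (κ : KroneckerType K) (t : ℕ) :
    κ.kind = Kind.path t ↔ κ = KroneckerType.tType t := by
  cases κ <;> simp [kind]

theorem kind_eq_regular_iff (κ : KroneckerType K) : κ.kind = Kind.regular ↔ κ.IsSType := by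
  cases κ <;> simp [kind, IsSType]

theorem isCoprime_X_pow {p : K[X]} (n : ℕ) (hp : p.Monic) (hirr : Irreducible p) (hX : p ≠ X) :
    IsCoprime X (p ^ n) :=
  (((irreducible_X).coprime_iff_not_dvd).2 fun hd => hX
    (eq_of_monic_of_associated hp monic_X
      (irreducible_X.associated_of_dvd hirr hd).symm)).pow_right

/-- Each type has its own threshold for `k`; stating this with a filter yields a common `k` for
finitely many summands. -/
theorem eventually_isOfKind (κ : KroneckerType K) :
    ∀ᶠ k in atTop, IsOfKind k κ.toPair κ.kind := by
  cases κ with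
  | zeroT n hn =>
    obtain ⟨n, rfl⟩ := Nat.exists_eq_add_of_le' hn
    exact (eventually_gt_atTop n).mono fun k hk => isOfKind_zeroT hk
  | tZero n hn =>
    obtain ⟨n, rfl⟩ := Nat.exists_eq_add_of_le' hn
    exact (eventually_gt_atTop n).mono fun k hk => isOfKind_tZero hk
  | tType n => exact (eventually_gt_atTop n).mono fun k hk => isOfKind_tType hk
  | zeroTZero n => exact (eventually_gt_atTop n).mono fun k hk => isOfKind_zeroTZero hk
  | sType p n hp hirr hX hn =>
    exact Eventually.of_forall fun k => isOfKind_sType _ (hp.pow n) (isCoprime_X_pow n hp hirr hX) k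

end KroneckerType

/-! ### Uniqueness and the main theorem -/

namespace TsfPair

open Filter

variable {K : Type u} [Field K]

/-- Isomorphic direct sums have the same summands `T_t` and isomorphic regular parts. -/
theorem card_path_eq_and_nonempty_iso_regular {ι : Type w₁} {ι' : Type w₂} [Finite ι] [Finite ι']
    {P : ι → TsfPair.{u, v₁} K} {P' : ι' → TsfPair.{u, v₂} K} {d : ι → Kind} {d' : ι' → Kind}
    (h : ∀ i, ∀ᶠ k in atTop, IsOfKind k (P i) (d i))
    (h' : ∀ i, ∀ᶠ k in atTop, IsOfKind k (P' i) (d' i))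
    (e : Iso (directSum P) (directSum P')) :
    (∀ t, Nat.card {i // d i = Kind.path t} = Nat.card {i // d' i = Kind.path t}) ∧
    Nonempty (Iso (directSum fun i : {i // d i = Kind.regular} => P i.1)
      (directSum fun i : {i // d' i = Kind.regular} => P' i.1)) := by
  -- The invariants of both sums are compared at the same number of steps, so one `k` must serve all
  -- summands on both sides.
  obtain ⟨k, hk, hk'⟩ := ((eventually_all.2 h).and (eventually_all.2 h')).exists
  refine ⟨fun t => ?_, ((regularPart hk).ofIso e).nonempty_iso (regularPart hk')⟩
  have h1 := card_path hk t
  rw [e.iterDim_eq, e.iterDim_eq, e.iterDim_eq, ← card_path hk' t] at h1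
  exact_mod_cast h1

end TsfPair

/-- Let `C^{∞,∞} Γ` be the disjoint union of the paths `L(m_i)` and the cycles `C(n_j)`.  Then
`K(Γ)` has a Kronecker decomposition, and in every Kronecker decomposition of `K(Γ)` the summands
of type `T_t` are, with multiplicity, the `T_{m_i - 1}`, and the direct sum of the summands of
type `S(p^n)` is isomorphic to the direct sum of the `S(X^{n_j} - 1)`. -/
theorem theorem5p4 (K : Type u) [Field K] (Γ : BinRel.{v}) [Finite Γ.carrier]
    (p q : ℕ) (m : Fin p → ℕ) (n : Fin q → ℕ) (hm : ∀ i, 1 ≤ m i) (hn : ∀ j, 1 ≤ n j)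
    (hΓ : Nonempty (BinRel.Iso Γ.cStabilization
      (BinRel.disjointUnion
        (Sum.elim (fun i : Fin p => BinRel.path (m i)) (fun j : Fin q => BinRel.cycle (n j)))))) :
    (∃ (r : ℕ) (κ : Fin r → KroneckerType K),
      (Γ.linearization K).IsKroneckerDecomposition κ) ∧
    ∀ (r : ℕ) (κ : Fin r → KroneckerType K),
      (Γ.linearization K).IsKroneckerDecomposition κ →
        (∀ t : ℕ, Nat.card {i // κ i = KroneckerType.tType t} = Nat.card {i // m i = t + 1}) ∧
        Nonempty (TsfPair.Iso
          (TsfPair.directSum fun i : {i // (κ i).IsSType} => (κ i.1).toPair)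
          (TsfPair.directSum fun j : Fin q =>
            TsfPair.sType (Polynomial.X ^ n j - 1 : Polynomial K)
              (Polynomial.monic_X_pow_sub_C 1 (Nat.one_le_iff_ne_zero.mp (hn j))))) := by
  have hF : ∀ j, (X ^ n j - 1 : K[X]).Monic := fun j =>
    monic_X_pow_sub_C 1 (Nat.one_le_iff_ne_zero.mp (hn j))
  have hX : ∀ j, IsCoprime X (X ^ n j - 1 : K[X]) := fun j =>
    TsfPair.isCoprime_X_X_pow_sub_one (hn j)
  have hsum := BinRel.isSumWithNull_linearization K Γ p q m n hm hn hF hΓ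
  refine ⟨hsum.exists_isKroneckerDecomposition ?_, fun r κ ⟨e⟩ => ?_⟩
  · rintro (i | j)
    · exact TsfPair.exists_isKroneckerDecomposition_of_type (KroneckerType.tType (m i - 1))
    · exact TsfPair.exists_isKroneckerDecomposition_sType _ (hF j) (hX j)
  · obtain ⟨J, hJ, c, ⟨f⟩⟩ := hsum
    let d' : (Fin p ⊕ Fin q) ⊕ J → TsfPair.Kind := Sum.elim
      (Sum.elim (fun i => .path (m i - 1)) (fun _ => .regular)) (fun _ => .null)
    -- The given decomposition is compared with the sum coming from the stabilization. There the
    -- pairs `S(X^{n_j} - 1)` need not belong to Kronecker's list, but they are of regular kind.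
    obtain ⟨h1, ⟨e'⟩⟩ := TsfPair.card_path_eq_and_nonempty_iso_regular
      (fun i => (κ i).eventually_isOfKind) (d' := d') (by
        rintro ((i | j) | j)
        · exact (KroneckerType.tType (m i - 1)).eventually_isOfKind
        · exact Filter.Eventually.of_forall fun k => TsfPair.isOfKind_sType _ (hF j) (hX j) k
        · have h2 := ((c j).toKroneckerType K).eventually_isOfKind
          rw [NullType.toPair_toKroneckerType] at h2
          have h3 : ((c j).toKroneckerType K).kind = .null := by
            cases c j <;> rfl
          rw [h3] at h2
          exact h2) (e.symm.trans f)
    constructor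
    · intro t
      have h2 : Nat.card {i // κ i = KroneckerType.tType t} =
          Nat.card {i // (κ i).kind = .path t} :=
        Nat.card_congr (Equiv.subtypeEquivRight fun i => ((κ i).kind_eq_path_iff t).symm)
      rw [h2, h1 t]
      refine (Nat.card_congr (Equiv.ofBijective
        (fun i : {i // m i = t + 1} => (⟨Sum.inl (Sum.inl i.1), ?_⟩ : {k // d' k = .path t}))
        ⟨?_, ?_⟩)).symm
      · change TsfPair.Kind.path (m i.1 - 1) = .path t
        rw [i.2, Nat.add_sub_cancel]
      · intro i i' hii
        exact Subtype.ext (Sum.inl.inj (Sum.inl.inj (congrArg Subtype.val hii)))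
      · rintro ⟨(i | j) | j, hk⟩
        -- The subtraction is truncated; `1 ≤ m i` turns this into `m i = t + 1`.
        · have h3 : m i - 1 = t := TsfPair.Kind.path.inj hk
          have h4 := hm i
          exact ⟨⟨i, by omega⟩, rfl⟩
        · exact TsfPair.Kind.noConfusion hk
        · exact TsfPair.Kind.noConfusion hk
    · obtain ⟨e₁⟩ := TsfPair.nonempty_iso_directSum_reindex (K := K)
        (Equiv.subtypeEquivRight fun i => ((κ i).kind_eq_regular_iff).symm)
        (P := fun i : {i // (κ i).IsSType} => (κ i.1).toPair)
        (Q := fun i : {i // (κ i).kind = .regular} => (κ i.1).toPair)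
        fun i => ⟨TsfPair.Iso.refl _⟩
      let s : Fin q ≃ {k // d' k = .regular} := Equiv.ofBijective
        (fun j => ⟨Sum.inl (Sum.inr j), rfl⟩) ⟨fun j j' hjj =>
          Sum.inr.inj (Sum.inl.inj (congrArg Subtype.val hjj)), by
            rintro ⟨(i | j) | j, hk⟩
            · exact TsfPair.Kind.noConfusion hk
            · exact ⟨j, rfl⟩
            · exact TsfPair.Kind.noConfusion hk⟩
      obtain ⟨e₂⟩ := TsfPair.nonempty_iso_directSum_reindex (K := K) s
        (P := fun j => TsfPair.sType (X ^ n j - 1) (hF j))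
        (Q := fun k : {k // d' k = .regular} => Sum.elim (Sum.elim
          (fun i => TsfPair.tType K (m i - 1)) (fun j => TsfPair.sType (X ^ n j - 1) (hF j)))
          (fun j => (c j).toPair K) k.1)
        fun j => ⟨TsfPair.Iso.refl _⟩
      exact ⟨(e₁.trans e').trans e₂.symm⟩
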